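/- **Conventions.** If $(X,A)$ is a pair of spaces, $E\to X$ a complex vector bundle of rank $r$ and $f=(f_1,\dots,f_r)$ a continuous complex frame of $E|_A$, then the relative first Chern class $c_1(E,f)\in H^2(X,A;\mathbb Z)$ (singular cohomology) is the primary obstruction to extending $f$ to a frame of $E$ over $X$. It is represented by the following relative cocycle: choose a frame of $E$ over the singular $1$-skeleton of $X$ that agrees with $f$ on $A$ (a basis of the fibre at each point of $X$, and along each path a continuous frame restricting to the chosen bases at its ends); the value of the cocycle on a singular $2$-simplex $\sigma$ is the winding number around $\partial\Delta^2$ of the determinant of the chosen frame on $\partial\Delta^2$ relative to a frame of $\sigma^*E$ over all of $\Delta^2$. (For a line bundle, a frame is a nowhere zero section.) **Proposition (Relative Adjunction Formula).** Let $(W,J)$ be a smooth almost complex $4$-manifold with boundary and let $P_J=T\partial W\cap J\,T\partial W$ be the induced plane field on $\partial W$. Let $(\Sigma,\partial\Sigma)\subset(W,\partial W)$ be a smooth, properly embedded $J$-holomorphic curve (a closed subset with $\Sigma\cap\partial W=\partial\Sigma$, carrying the almost complex structure $j=J|_{T\Sigma}$ and the corresponding orientation) whose boundary is transverse to $P_J$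 in $\partial W$. Let $\nu\Sigma$ be its normal bundle, that is, a complex line subbundle of $(TW|_\Sigma,J)$ with $TW|_\Sigma=T\Sigma\oplus\nu\Sigma$. Let $s_\tau$ be a continuous vector field along $\partial\Sigma$ that is tangent to $\partial\Sigma$, nowhere zero and positive for the boundary orientation of $\partial\Sigma$ (for example the oriented unit tangent field of $\partial\Sigma$ for any Riemannian metric). Then for every continuous nowhere vanishing section $s$ of $\nu\Sigma$ along $\partial\Sigma$, the relative first Chern classes $c_1(TW|_\Sigma,s_\tau\oplus s)$, $c_1(T\Sigma,s_\tau)$ and $c_1(\nu\Sigma,s)$ are well defined (the cocycles above exist and all represent one and the same class), and $$c_1(TW|_\Sigma,s_\tau\oplus s)=c_1(T\Sigma,s_\tau)+c_1(\nu\Sigma,s)\quad\text{in } H^2(\Sigma,\partial\Sigma;\mathbb Z),$$ where $s_\tau\oplus s$ is the frame $(s_\tau,s)$ of $TW|_\Sigma$ along $\partial\Sigma$. -/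

import Mathlib

open Set Bundle
open scoped Manifold ContDiff

noncomputable section

namespace RelChern

/-! ### Relative singular cohomology with integer coefficients -/

section Cohomology

/-- The standard topological `n`-simplex. -/
abbrev Simplex (n : ℕ) : Type := stdSimplex ℝ (Fin (n + 1))

/-- The inclusion of the `k`-th face (opposite to the `k`-th vertex). -/
def face {n : ℕ} (k : Fin (n + 2)) : C(Simplex n, Simplex (n + 1)) :=
  ⟨stdSimplex.map (k.succAbove), stdSimplex.continuous_map _⟩

variable (X : Type*) [TopologicalSpace X]

/-- Integral singular `n`-cochains of `X`, as functions on the singular `n`-simplices. -/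
abbrev Cochain (n : ℕ) : Type _ := C(Simplex n, X) → ℤ

/-- The singular coboundary, `(δ c)(σ) = ∑ (-1)^k c(σ ∘ face k)`. -/
def coboundary (n : ℕ) : Cochain X n →+ Cochain X (n + 1) where
  toFun c σ := ∑ k : Fin (n + 2), (-1) ^ (k : ℕ) * c (σ.comp (face k))
  map_zero' := by ext σ; simp
  map_add' c d := by ext σ; simp [mul_add, Finset.sum_add_distrib]

variable {X} (A : Set X)

/-- Cochains of the pair `(X, A)`: those which vanish on all simplices contained in `A`. -/
def relCochains (n : ℕ) : AddSubgroup (Cochain X n) where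
  carrier := {c | ∀ σ : C(Simplex n, X), range σ ⊆ A → c σ = 0}
  zero_mem' := fun _ _ => rfl
  add_mem' := fun hc hd σ hσ => by simp [hc σ hσ, hd σ hσ]
  neg_mem' := fun hc σ hσ => by simp [hc σ hσ]

/-- Relative cocycles. -/
def relCocycles (n : ℕ) : AddSubgroup (Cochain X n) :=
  relCochains A n ⊓ (coboundary X n).ker

/-- Coboundaries of relative cochains. -/
def relCoboundaries : (n : ℕ) → AddSubgroup (Cochain X n)
  | 0 => ⊥
  | n + 1 => (relCochains A n).map (coboundary X n)

/-- The relative singular cohomology group `Hⁿ(X, A; ℤ)`. -/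
abbrev RelCohomology (n : ℕ) : Type _ :=
  relCocycles A n ⧸ (relCoboundaries A n).addSubgroupOf (relCocycles A n)

end Cohomology

/-! ### Complex vector bundles and frames

A complex vector bundle over `X` is given as a family `V` of subspaces of a real vector bundle `E`
over `X`, with complex multiplication by `i` given by a bundle endomorphism `J` of `E`
(`V = ⊤` gives the whole bundle `(E, J)`). -/

section Frames

/-- The complex linear combination `∑ cᵢ fᵢ` in a real vector space whose multiplication by the
imaginary unit is `J`. -/
def complexComb {M : Type*} [AddCommMonoid M] [Module ℝ M] (J : M →ₗ[ℝ] M) {r : ℕ}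
    (f : Fin r → M) (c : Fin r → ℂ) : M :=
  ∑ i, ((c i).re • f i + (c i).im • J (f i))

/-- `f` is a basis of `V` over the complex numbers. -/
def IsComplexBasis {M : Type*} [AddCommMonoid M] [Module ℝ M] (J : M →ₗ[ℝ] M)
    (V : Submodule ℝ M) {r : ℕ} (f : Fin r → M) : Prop :=
  Function.Injective (complexComb J f) ∧ range (complexComb J f) = (V : Set M)

variable {X : Type*} [TopologicalSpace X] {F : Type*} {E : X → Type*}
  [∀ x, AddCommMonoid (E x)] [∀ x, Module ℝ (E x)] [TopologicalSpace (TotalSpace F E)]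

variable (F) in
/-- `f` is a continuous complex frame of the pullback of the bundle `V` along `σ : K → X`. -/
structure IsFrameAlong {K : Type*} [TopologicalSpace K] (J : ∀ x, E x →ₗ[ℝ] E x)
    (V : ∀ x, Submodule ℝ (E x)) {r : ℕ} (σ : K → X) (f : Fin r → ∀ k, E (σ k)) : Prop where
  continuous : ∀ i, Continuous fun k => (⟨σ k, f i k⟩ : TotalSpace F E)
  basis : ∀ k, IsComplexBasis (J (σ k)) (V (σ k)) fun i => f i k

variable (F) in
/-- `V` is a (locally trivial) complex vector bundle of rank `r`: every point has a neighbourhood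
over which `V` has a continuous complex frame with `r` members. -/
def IsComplexSubbundle (J : ∀ x, E x →ₗ[ℝ] E x) (V : ∀ x, Submodule ℝ (E x)) (r : ℕ) : Prop :=
  ∀ x : X, ∃ U : Set X, IsOpen U ∧ x ∈ U ∧
    ∃ f : Fin r → ∀ u : U, E u, IsFrameAlong F J V (fun u : U => (u : X)) f

variable (F) in
/-- A frame of `V` over the singular 1-skeleton of `X` that agrees with the given frame `s`
on `A`: a basis of the fibre at each point, and a continuous frame along each path which restricts
to the chosen bases at the two ends. -/
structure SkeletonFrame (J : ∀ x, E x →ₗ[ℝ] E x) (V : ∀ x, Submodule ℝ (E x)) {r : ℕ} (A : Set X)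
    (s : Fin r → ∀ x : A, E x) where
  vertex : ∀ x, Fin r → E x
  vertex_basis : ∀ x, IsComplexBasis (J x) (V x) (vertex x)
  vertex_eq : ∀ (x : X) (hx : x ∈ A) (i : Fin r), vertex x i = s i ⟨x, hx⟩
  edge : ∀ σ : C(Simplex 1, X), Fin r → ∀ t, E (σ t)
  edge_frame : ∀ σ : C(Simplex 1, X), IsFrameAlong F J V σ (edge σ)
  edge_end : ∀ (σ : C(Simplex 1, X)) (m : Fin 2) (i : Fin r),
    edge σ i (stdSimplex.vertex m) = vertex (σ (stdSimplex.vertex m)) i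
  edge_eq : ∀ (σ : C(Simplex 1, X)) (hσ : range σ ⊆ A) (i : Fin r) (t : Simplex 1),
    edge σ i t = s i ⟨σ t, hσ (mem_range_self t)⟩

variable {J : ∀ x, E x →ₗ[ℝ] E x} {V : ∀ x, Submodule ℝ (E x)} {r : ℕ} {A : Set X}
  {s : Fin r → ∀ x : A, E x}

/-- `z` is the variation of the logarithm of `γ` along the path `γ` of nonzero complex numbers. -/
def IsLogVariation (γ : Simplex 1 → ℂ) (z : ℂ) : Prop :=
  ∃ θ : C(Simplex 1, ℂ), (∀ t, γ t = Complex.exp (θ t)) ∧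
    z = θ (stdSimplex.vertex 1) - θ (stdSimplex.vertex 0)

/-- `n` is the obstruction to extending the frame `Φ` from the boundary of the singular 2-simplex
`σ` to its interior: with respect to a frame `g` along the whole of `σ`, the frame `Φ` becomes a
loop of invertible matrices parametrized by the boundary of the simplex, and `n` is its class in
`π₁(GL_r(ℂ)) = ℤ`, that is, the winding number of its determinant. The boundary is traversed as
face 2, then face 0, then face 1 backwards (vertices `0 → 1 → 2 → 0`). -/
def IsObstruction (Φ : SkeletonFrame F J V A s) (σ : C(Simplex 2, X)) (n : ℤ) : Prop :=
  ∃ g : Fin r → ∀ p, E (σ p), IsFrameAlong F J V σ g ∧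
  ∃ (M : Fin 3 → Simplex 1 → Matrix (Fin r) (Fin r) ℂ) (z : Fin 3 → ℂ),
    (∀ k t j, Φ.edge (σ.comp (face k)) j t =
      complexComb (J (σ (face k t))) (fun i => g i (face k t)) (fun i => M k t i j)) ∧
    (∀ k, IsLogVariation (fun t => (M k t).det) (z k)) ∧
    z 2 + z 0 - z 1 = 2 * Real.pi * Complex.I * n

variable (F J V A s)

/-- `z` is a first Chern class of the complex vector bundle `V` relative to the frame `s` over `A`:
the primary obstruction to extending `s` to a frame over all of `X`, i.e. the class of the cocycle
which assigns to each singular 2-simplex the obstruction to extending over it some frame on the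
singular 1-skeleton that agrees with `s` on `A`. -/
def IsRelChernClass (z : RelCohomology A 2) : Prop :=
  ∃ (Φ : SkeletonFrame F J V A s) (c : relCocycles A 2),
    (∀ σ, IsObstruction Φ σ (c.1 σ)) ∧ z = QuotientAddGroup.mk c

open Classical in
/-- The first Chern class `c₁(V, s) ∈ H²(X, A; ℤ)` of `V` relative to the frame `s` over `A`. -/
def relChernClass : RelCohomology A 2 :=
  if h : ∃ z, IsRelChernClass F J V A s z then h.choose else 0

end Frames

/-! ### Almost complex manifolds with boundary and holomorphic curves in them -/

section Manifolds

variable {n : ℕ} [NeZero n] {M : Type*} [TopologicalSpace M]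
  [ChartedSpace (EuclideanHalfSpace n) M]

variable (n M) in
/-- A smooth almost complex structure on the manifold with boundary `M`. -/
structure AlmostComplexStructure [IsManifold (𝓡∂ n) ∞ M] where
  J : ∀ x : M, TangentSpace (𝓡∂ n) x →ₗ[ℝ] TangentSpace (𝓡∂ n) x
  sq : ∀ (x : M) (v : TangentSpace (𝓡∂ n) x), J x (J x v) = -v
  smooth : ContMDiff (𝓡∂ n).tangent (𝓡∂ n).tangent ∞
    fun p : TangentBundle (𝓡∂ n) M => (⟨p.1, J p.1 p.2⟩ : TangentBundle (𝓡∂ n) M)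

/-- The inward normal component of a tangent vector `v` at a boundary point `x`: the derivative
along `v` of the coordinate (nonnegative on the half space) of a chart at `x` that vanishes on the
boundary. -/
def normalComponent (x : M) : TangentSpace (𝓡∂ n) x →ₗ[ℝ] ℝ :=
  (EuclideanSpace.proj (0 : Fin n) : EuclideanSpace ℝ (Fin n) →L[ℝ] ℝ).toLinearMap ∘ₗ
    (mfderiv (𝓡∂ n) 𝓘(ℝ, EuclideanSpace ℝ (Fin n)) (extChartAt (𝓡∂ n) x) x).toLinearMap

/-- The tangent space of the boundary at a boundary point `x`, as a subspace of `T_x M`. -/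
def boundaryTangent (x : M) : Submodule ℝ (TangentSpace (𝓡∂ n) x) :=
  LinearMap.ker (normalComponent x)

/-- The plane field `P_J = TY ∩ J TY` on the boundary `Y` of `M`. -/
def planeField [IsManifold (𝓡∂ n) ∞ M] (J : AlmostComplexStructure n M) (y : M) :
    Submodule ℝ (TangentSpace (𝓡∂ n) y) :=
  boundaryTangent y ⊓ (boundaryTangent y).map (J.J y)

/-- The positive tangent vectors of the boundary of a surface `S` oriented by an almost complex
structure `j`: vectors `v` tangent to the boundary such that (outward normal, `v`) is an oriented
basis, in other words such that `-j v` points outward. -/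
def IsPositiveBoundaryTangent {S : Type*} [TopologicalSpace S]
    [ChartedSpace (EuclideanHalfSpace 2) S] [IsManifold (𝓡∂ 2) ∞ S]
    (j : AlmostComplexStructure 2 S) (x : S) (v : TangentSpace (𝓡∂ 2) x) : Prop :=
  v ∈ boundaryTangent x ∧ normalComponent x (-(j.J x v)) < 0

variable {S W : Type*} [TopologicalSpace S] [ChartedSpace (EuclideanHalfSpace 2) S]
  [TopologicalSpace W] [ChartedSpace (EuclideanHalfSpace 4) W]

/-- A smooth proper embedding `(S, ∂S) → (W, ∂W)` of a surface: a smooth map with injective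
differentials that is a homeomorphism onto a closed subset, and such that exactly the boundary
points of `S` are sent to the boundary of `W`. -/
structure IsProperEmbedding (φ : S → W) : Prop where
  smooth : ContMDiff (𝓡∂ 2) (𝓡∂ 4) ∞ φ
  closedEmbedding : Topology.IsClosedEmbedding φ
  injective : ∀ x, Function.Injective (mfderiv (𝓡∂ 2) (𝓡∂ 4) φ x)
  boundary : ∀ x, φ x ∈ (𝓡∂ 4).boundary W ↔ x ∈ (𝓡∂ 2).boundary S

variable [IsManifold (𝓡∂ 2) ∞ S] [IsManifold (𝓡∂ 4) ∞ W]

/-- The Cauchy-Riemann equation `dφ ∘ j = J ∘ dφ`. -/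
def IsJHolomorphic (j : AlmostComplexStructure 2 S) (J : AlmostComplexStructure 4 W)
    (φ : S → W) : Prop :=
  ∀ (x : S) (v : TangentSpace (𝓡∂ 2) x),
    mfderiv (𝓡∂ 2) (𝓡∂ 4) φ x (j.J x v) = J.J (φ x) (mfderiv (𝓡∂ 2) (𝓡∂ 4) φ x v)

/-- The boundary of the surface is transverse, inside the boundary of `W`, to the plane field
`P_J`. -/
def IsBoundaryTransverse (J : AlmostComplexStructure 4 W) (φ : S → W) : Prop :=
  ∀ x ∈ (𝓡∂ 2).boundary S,
    (boundaryTangent x).map (mfderiv (𝓡∂ 2) (𝓡∂ 4) φ x).toLinearMap ⊔ planeField J (φ x) =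
      boundaryTangent (φ x)

/-- The complex structure on the restriction `TW|_S`, that is, on the pullback of `TW` by `φ`. -/
def pullbackJ (J : AlmostComplexStructure 4 W) (φ : S → W) (x : S) :
    (φ *ᵖ (TangentSpace (𝓡∂ 4) : W → Type _)) x →ₗ[ℝ]
      (φ *ᵖ (TangentSpace (𝓡∂ 4) : W → Type _)) x :=
  J.J (φ x)

/-- `ν` is a normal bundle of the holomorphic curve `φ`: a complex line subbundle of `TW|_S` such
that `TW|_S = TS ⊕ ν`. -/
structure IsNormalBundle (J : AlmostComplexStructure 4 W) (φ : S → W)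
    (ν : ∀ x, Submodule ℝ ((φ *ᵖ (TangentSpace (𝓡∂ 4) : W → Type _)) x)) : Prop where
  subbundle : IsComplexSubbundle (EuclideanSpace ℝ (Fin 4)) (pullbackJ J φ) ν 1
  isCompl : ∀ x : S,
    IsCompl (mfderiv (𝓡∂ 2) (𝓡∂ 4) φ x).toLinearMap.range
      (ν x : Submodule ℝ (TangentSpace (𝓡∂ 4) (φ x)))

/-- The section `dφ(τ)` of `TW|_S` over the boundary of `S`. -/
def pushforwardSection (φ : S → W)
    (τ : ∀ x : (𝓡∂ 2).boundary S, TangentSpace (𝓡∂ 2) (x : S))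
    (x : (𝓡∂ 2).boundary S) : (φ *ᵖ (TangentSpace (𝓡∂ 4) : W → Type _)) (x : S) :=
  mfderiv (𝓡∂ 2) (𝓡∂ 4) φ (x : S) (τ x)

end Manifolds

end RelChern

end

open RelChern

/-! Determinants turn direct sums into products, and winding numbers turn products into sums. If f
and g are frames of TΣ and of ν over the singular 1-skeleton, then (dφ f, g) is such a frame of
TW|_Σ. Relative to a reference frame that splits in the same way, its transition matrix is diagonal,
so its determinant is the product of the two determinants and the obstruction on each 2-simplex is
the sum of the two obstructions (`changeDet_pair`, `IsObstruction.pair`). For these frames the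
formula holds already on cocycles.

What remains is independence of choices. By `IsComplexBasis.changeDet_mul`, another reference frame
over a 2-simplex multiplies the boundary loop by a function with a logarithm on the whole simplex,
which leaves the winding number unchanged (`IsObstruction.eq_boundary`). The cocycle condition is
the cancellation of edges on the boundary of a tetrahedron, and two skeleton frames give cocycles
that differ by the coboundary of a relative cochain (`obstruction_sub_mem_relCoboundaries`).

Existence rests on the triviality of line bundles along simplices
(`IsComplexSubbundle.exists_isFrameAlong`): generating sections attach to each fibre a line in ℂᴺ,
and a vector fixed by the projection onto that line is carried along a contraction in small steps.
Rescaling by an exponential then gives frames of edges with prescribed ends. -/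

open RelChern

noncomputable section

namespace RelChern

/-! ### Complex bases and change of basis determinants -/

section Algebra

variable {M : Type*} [AddCommMonoid M] [Module ℝ M] {J : M →ₗ[ℝ] M} {V : Submodule ℝ M} {r : ℕ}

variable (J) in
/-- `complexComb` as a real linear map in the coefficients. -/
def complexCombL (f : Fin r → M) : (Fin r → ℂ) →ₗ[ℝ] M where
  toFun := complexComb J f
  map_add' c d := by
    let _ := Module.addCommMonoidToAddCommGroup ℝ (M := M)
    simp only [complexComb, ← Finset.sum_add_distrib]
    refine Finset.sum_congr rfl fun i _ => ?_
    simp only [Pi.add_apply, Complex.add_re, Complex.add_im]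
    module
  map_smul' a c := by
    let _ := Module.addCommMonoidToAddCommGroup ℝ (M := M)
    simp only [complexComb, Finset.smul_sum]
    refine Finset.sum_congr rfl fun i _ => ?_
    simp only [Pi.smul_apply, Complex.real_smul, Complex.re_ofReal_mul, Complex.im_ofReal_mul,
      RingHom.id_apply]
    module

@[simp] lemma complexCombL_apply (f : Fin r → M) (c : Fin r → ℂ) :
    complexCombL J f c = complexComb J f c := rfl

/-- The condition J² = -1 is written with the scalar -1 because the fibres are only additive
monoids, without a negation. -/
lemma complexComb_mul (hJ : ∀ v, J (J v) = (-1 : ℝ) • v) (a : ℂ) (f : Fin r → M)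
    (c : Fin r → ℂ) :
    complexComb J f (fun i => a * c i) =
      a.re • complexComb J f c + a.im • J (complexComb J f c) := by
  let _ := Module.addCommMonoidToAddCommGroup ℝ (M := M)
  simp only [complexComb, map_sum, Finset.smul_sum, ← Finset.sum_add_distrib]
  refine Finset.sum_congr rfl fun i _ => ?_
  simp only [map_add, map_smul, hJ, Complex.mul_re, Complex.mul_im]
  module

lemma complexComb_complexComb (hJ : ∀ v, J (J v) = (-1 : ℝ) • v) {q : ℕ} (g : Fin r → M)
    (A : Matrix (Fin r) (Fin q) ℂ) (c : Fin q → ℂ) :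
    complexComb J (fun j => complexComb J g fun i => A i j) c =
      complexComb J g (A.mulVec c) := by
  have h : A.mulVec c = ∑ j, fun i => c j * A i j := by
    ext i; simp [Matrix.mulVec, dotProduct, mul_comm]
  rw [h, ← complexCombL_apply (J := J) g, map_sum]
  simp only [complexCombL_apply, complexComb_mul hJ]
  rfl

lemma complexComb_single (f : Fin r → M) (j : Fin r) :
    complexComb J f (Pi.single j 1) = f j := by
  rw [complexComb, Finset.sum_eq_single j]
  · simp
  · intro i _ hi; simp [Pi.single_eq_of_ne hi]
  · simp

lemma complexComb_fin_one (f : Fin 1 → M) (c : Fin 1 → ℂ) :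
    complexComb J f c = (c 0).re • f 0 + (c 0).im • J (f 0) := by
  simp [complexComb]

variable (J) in
/-- The complex coordinates of `v` with respect to `g`. -/
def coords (g : Fin r → M) (v : M) : Fin r → ℂ := Function.invFun (complexComb J g) v

lemma IsComplexBasis.coords_spec {g : Fin r → M} (hg : IsComplexBasis J V g) {v : M}
    (hv : v ∈ V) : complexComb J g (coords J g v) = v :=
  Function.invFun_eq (by rw [← mem_range, hg.2]; exact hv)

lemma IsComplexBasis.mem {g : Fin r → M} (hg : IsComplexBasis J V g) (c : Fin r → ℂ) :
    complexComb J g c ∈ V := by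
  have : complexComb J g c ∈ range (complexComb J g) := mem_range_self c
  rwa [hg.2] at this

lemma IsComplexBasis.mem_apply {g : Fin r → M} (hg : IsComplexBasis J V g) (i : Fin r) :
    g i ∈ V := by
  rw [← complexComb_single (J := J) g i]; exact hg.mem _

lemma IsComplexBasis.coords_comb {g : Fin r → M} (hg : IsComplexBasis J V g) (c : Fin r → ℂ) :
    coords J g (complexComb J g c) = c :=
  hg.1 (hg.coords_spec (hg.mem c))

variable (J) in
/-- The matrix of `f` with respect to `g`. -/
def changeMatrix (g f : Fin r → M) : Matrix (Fin r) (Fin r) ℂ :=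
  Matrix.of fun i j => coords J g (f j) i

lemma IsComplexBasis.changeMatrix_spec {g f : Fin r → M} (hg : IsComplexBasis J V g)
    (hf : ∀ j, f j ∈ V) (j : Fin r) :
    f j = complexComb J g fun i => changeMatrix J g f i j :=
  (hg.coords_spec (hf j)).symm

lemma IsComplexBasis.changeMatrix_unique {g f : Fin r → M} (hg : IsComplexBasis J V g)
    {A : Matrix (Fin r) (Fin r) ℂ} (h : ∀ j, f j = complexComb J g fun i => A i j) :
    changeMatrix J g f = A := by
  ext i j
  simp only [changeMatrix, Matrix.of_apply, h j]
  exact congrFun (hg.coords_comb _) i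

variable (J) in
/-- The determinant of `f` with respect to `g`. -/
def changeDet (g f : Fin r → M) : ℂ := (changeMatrix J g f).det

lemma IsComplexBasis.changeDet_eq {g f : Fin r → M} (hg : IsComplexBasis J V g)
    {A : Matrix (Fin r) (Fin r) ℂ} (h : ∀ j, f j = complexComb J g fun i => A i j) :
    changeDet J g f = A.det := by
  rw [changeDet, hg.changeMatrix_unique h]

lemma IsComplexBasis.changeDet_self {g : Fin r → M} (hg : IsComplexBasis J V g) :
    changeDet J g g = 1 := by
  rw [hg.changeDet_eq (A := 1), Matrix.det_one]
  intro j
  conv_lhs => rw [← complexComb_single (J := J) g j]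
  congr 1
  ext i
  simp [Pi.single_apply, Matrix.one_apply]

/-- Transition matrices compose, by `complexComb_complexComb`. The independence statements below are
this identity read through logarithms. -/
lemma IsComplexBasis.changeDet_mul (hJ : ∀ v, J (J v) = (-1 : ℝ) • v) {h g f : Fin r → M}
    (hh : IsComplexBasis J V h) (hg : IsComplexBasis J V g) (hf : ∀ j, f j ∈ V) :
    changeDet J h f = changeDet J h g * changeDet J g f := by
  rw [changeDet.eq_def J h g, changeDet.eq_def J g f, ← Matrix.det_mul]
  refine hh.changeDet_eq fun j => ?_
  have h1 := hg.changeMatrix_spec hf j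
  have h2 : g = fun j => complexComb J h fun i => changeMatrix J h g i j :=
    funext fun j => hh.changeMatrix_spec hg.mem_apply j
  conv at h1 => rhs; rw [h2]
  rw [complexComb_complexComb hJ, ← h2] at h1
  exact h1

lemma IsComplexBasis.changeDet_ne_zero (hJ : ∀ v, J (J v) = (-1 : ℝ) • v) {g f : Fin r → M}
    (hg : IsComplexBasis J V g) (hf : IsComplexBasis J V f) : changeDet J g f ≠ 0 := by
  have h := hg.changeDet_mul hJ hf hg.mem_apply
  rw [hg.changeDet_self] at h
  intro h0
  simp [h0] at h

lemma IsComplexBasis.of_mem_of_ne_zero (hJ : ∀ v, J (J v) = (-1 : ℝ) • v) {g : Fin 1 → M}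
    (hg : IsComplexBasis J V g) {f : Fin 1 → M} (hf : f 0 ∈ V) (h0 : f 0 ≠ 0) :
    IsComplexBasis J V f := by
  set a := coords J g (f 0) with ha
  have hfa : complexComb J g a = f 0 := hg.coords_spec hf
  have ha0 : a 0 ≠ 0 := by
    intro h
    apply h0
    rw [← hfa, complexComb_fin_one, h]
    simp
  have hf' : f = fun _ => complexComb J g fun i => a i := by
    ext i; rw [Subsingleton.elim i 0]; exact hfa.symm
  have key : ∀ c : Fin 1 → ℂ, complexComb J f c = complexComb J g fun i => a i * c 0 := by
    intro c
    rw [hf', complexComb_complexComb hJ g (fun i _ => a i)]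
    congr 1
    ext i
    simp [Matrix.mulVec, dotProduct]
  constructor
  · intro c d h
    rw [key, key] at h
    have := congrFun (hg.1 h) 0
    ext i
    rw [Subsingleton.elim i 0]
    exact mul_left_cancel₀ ha0 this
  · rw [← hg.2]
    ext v
    constructor
    · rintro ⟨c, rfl⟩
      exact ⟨_, (key c).symm⟩
    · rintro ⟨c, rfl⟩
      refine ⟨fun i => (a 0)⁻¹ * c 0, ?_⟩
      rw [key]
      congr 1
      ext i
      rw [Subsingleton.elim i 0, mul_inv_cancel_left₀ ha0]

end Algebra

/-! ### Logarithms along simplices -/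

section Log

lemma face_apply_face {n : ℕ} (k : Fin (n + 3)) (l : Fin (n + 2)) :
    (face k).comp (face l) =
      ⟨stdSimplex.map (k.succAbove ∘ l.succAbove), stdSimplex.continuous_map _⟩ := by
  ext1 x
  exact stdSimplex.map_comp_apply _ _ _

lemma face_vertex {n : ℕ} (k : Fin (n + 2)) (m : Fin (n + 1)) :
    face k (stdSimplex.vertex m) = stdSimplex.vertex (k.succAbove m) :=
  stdSimplex.map_vertex _ _

instance (n : ℕ) : ContractibleSpace (Simplex n) :=
  (convex_stdSimplex ℝ _).contractibleSpace ⟨_, single_mem_stdSimplex ℝ 0⟩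

instance (n : ℕ) : LocallyPathConnectedSpace (Simplex n) :=
  (convex_stdSimplex ℝ _).locallyPathConnectedSpace

/-- A simplex is simply connected and locally path connected, so maps to the nonzero complex numbers
lift through the covering exp. -/
lemma exists_log {n : ℕ} {f : Simplex n → ℂ} (hf : Continuous f) (h0 : ∀ x, f x ≠ 0) :
    ∃ θ : C(Simplex n, ℂ), ∀ x, f x = Complex.exp (θ x) := by
  obtain ⟨θ, ⟨-, h⟩, -⟩ := Complex.isCoveringMapOn_exp.existsUnique_continuousMap_lifts
    (⟨f, hf⟩ : C(Simplex n, ℂ)) (a₀ := stdSimplex.vertex 0)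
    (Complex.exp_log (h0 (stdSimplex.vertex 0))) h0
  exact ⟨θ, fun x => (congrFun h x).symm⟩

lemma exists_isLogVariation {γ : Simplex 1 → ℂ} (hγ : Continuous γ) (h0 : ∀ t, γ t ≠ 0) :
    ∃ z, IsLogVariation γ z := by
  obtain ⟨θ, h⟩ := exists_log hγ h0
  exact ⟨_, θ, h, rfl⟩

lemma IsLogVariation.mul {γ γ' : Simplex 1 → ℂ} {z z' : ℂ} (h : IsLogVariation γ z)
    (h' : IsLogVariation γ' z') : IsLogVariation (fun t => γ t * γ' t) (z + z') := by
  obtain ⟨θ, h, rfl⟩ := h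
  obtain ⟨θ', h', rfl⟩ := h'
  refine ⟨θ + θ', fun t => ?_, ?_⟩
  · simp [Complex.exp_add, h, h']
  · simp only [ContinuousMap.add_apply]; ring

lemma IsLogVariation.one : IsLogVariation (fun _ => 1) 0 := ⟨0, by simp, by simp⟩

/-- Two logarithms differ by a continuous lift of the constant 1 through exp, and such a lift is
constant. -/
lemma IsLogVariation.unique {γ : Simplex 1 → ℂ} {z z' : ℂ} (h : IsLogVariation γ z)
    (h' : IsLogVariation γ z') : z = z' := by
  obtain ⟨θ, h, rfl⟩ := h
  obtain ⟨θ', h', rfl⟩ := h'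
  have h1 : ∀ t, Complex.exp (θ t - θ' t) = 1 := fun t => by
    rw [Complex.exp_sub, ← h, ← h', div_self]
    rw [h t]
    exact Complex.exp_ne_zero _
  have key := Complex.isCoveringMap_exp.const_of_comp (g := fun t => θ t - θ' t)
    (by fun_prop) (fun a b => Subtype.ext ((h1 a).trans (h1 b).symm))
    (stdSimplex.vertex 1) (stdSimplex.vertex 0)
  linear_combination key

lemma IsLogVariation.exp_eq {γ : Simplex 1 → ℂ} {z : ℂ} (h : IsLogVariation γ z) :
    γ (stdSimplex.vertex 1) = Complex.exp z * γ (stdSimplex.vertex 0) := by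
  obtain ⟨θ, h, rfl⟩ := h
  rw [h, h, ← Complex.exp_add, sub_add_cancel]

lemma exists_int_of_exp_eq_one {z : ℂ} (h : Complex.exp z = 1) :
    ∃ n : ℤ, z = 2 * Real.pi * Complex.I * n := by
  obtain ⟨n, hn⟩ := Complex.exp_eq_one_iff.1 h
  exact ⟨n, by rw [hn]; ring⟩

lemma int_eq_of_two_pi_I_mul {m n : ℤ}
    (h : 2 * Real.pi * Complex.I * m = 2 * Real.pi * Complex.I * n) : m = n := by
  exact_mod_cast mul_left_cancel₀ Complex.two_pi_I_ne_zero h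

end Log


/-! ### Continuity of coordinates and of linear combinations -/

section Pullback

variable {X : Type*} {F : Type*} {E : X → Type*}
  [∀ x, AddCommMonoid (E x)] [∀ x, Module ℝ (E x)] [TopologicalSpace (TotalSpace F E)]
  {K : Type*} [TopologicalSpace K] {σ : K → X}
  {J : ∀ x, E x →ₗ[ℝ] E x} {V : ∀ x, Submodule ℝ (E x)} {r : ℕ}

lemma continuousAt_lift_J (hJc : Continuous fun p : TotalSpace F E => (⟨p.1, J p.1 p.2⟩ :
      TotalSpace F E)) {h : ∀ k, E (σ k)} {k₀ : K}
    (hh : ContinuousAt (fun k => (⟨σ k, h k⟩ : TotalSpace F E)) k₀) :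
    ContinuousAt (fun k => (⟨σ k, J (σ k) (h k)⟩ : TotalSpace F E)) k₀ :=
  ContinuousAt.comp (g := fun p : TotalSpace F E => (⟨p.1, J p.1 p.2⟩ : TotalSpace F E))
    hJc.continuousAt hh

lemma IsFrameAlong.comp {g : Fin r → ∀ k, E (σ k)} (hg : IsFrameAlong F J V σ g)
    {K' : Type*} [TopologicalSpace K'] {ρ : K' → K} (hρ : Continuous ρ) :
    IsFrameAlong F J V (fun k' => σ (ρ k')) fun i k' => g i (ρ k') :=
  ⟨fun i => (hg.continuous i).comp hρ, fun k' => hg.basis (ρ k')⟩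

end Pullback

section Continuity

open Filter Topology

/-- If P is a left inverse of L k₀, then P ∘ L k is 1 at k₀, hence invertible nearby. There c k is
its inverse applied to P (L k (c k)), and inversion is continuous. -/
lemma continuousAt_of_continuousAt_complexComb {K : Type*} [TopologicalSpace K] {F : Type*}
    [NormedAddCommGroup F] [NormedSpace ℝ F] [FiniteDimensional ℝ F] {r : ℕ}
    {L : K → (Fin r → ℂ) →L[ℝ] F} {c : K → Fin r → ℂ} {k₀ : K} (hL : ContinuousAt L k₀)
    (hinj : Function.Injective (L k₀)) (h : ContinuousAt (fun k => L k (c k)) k₀) :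
    ContinuousAt c k₀ := by
  obtain ⟨P, hP⟩ := LinearMap.exists_leftInverse_of_injective (L k₀).toLinearMap
    (LinearMap.ker_eq_bot.2 hinj)
  let P' : F →L[ℝ] (Fin r → ℂ) := LinearMap.toContinuousLinearMap P
  have hone : P'.comp (L k₀) = 1 := by
    ext1 v
    exact LinearMap.congr_fun hP v
  have hB : ContinuousAt (fun k => P'.comp (L k)) k₀ := continuousAt_const.clm_comp hL
  have hinv : ContinuousAt (fun k => Ring.inverse (P'.comp (L k))) k₀ := by
    refine ContinuousAt.comp (g := Ring.inverse) ?_ hB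
    rw [hone]
    exact NormedRing.inverse_continuousAt 1
  have hc : ContinuousAt (fun k => Ring.inverse (P'.comp (L k)) (P' (L k (c k)))) k₀ :=
    hinv.clm_apply (P'.continuous.continuousAt.comp h)
  have hu : ∀ᶠ k in 𝓝 k₀, IsUnit (P'.comp (L k)) := by
    have : {T : (Fin r → ℂ) →L[ℝ] (Fin r → ℂ) | IsUnit T} ∈ 𝓝 (P'.comp (L k₀)) := by
      rw [hone]
      exact Units.isOpen.mem_nhds isUnit_one
    exact hB this
  refine hc.congr ?_
  filter_upwards [hu] with k hk
  exact DFunLike.congr_fun (Ring.inverse_mul_cancel _ hk) (c k)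

variable {X : Type*} [TopologicalSpace X] {F : Type*} {E : X → Type*}
  [NormedAddCommGroup F] [NormedSpace ℝ F]
  [∀ x, AddCommMonoid (E x)] [∀ x, Module ℝ (E x)] [TopologicalSpace (TotalSpace F E)]
  [∀ x, TopologicalSpace (E x)] [FiberBundle F E] [VectorBundle ℝ F E]
  {K : Type*} [TopologicalSpace K] {σ : K → X}

lemma continuousAt_lift_iff (hσ : Continuous σ) (h : ∀ k, E (σ k)) (k₀ : K) :
    ContinuousAt (fun k => (⟨σ k, h k⟩ : TotalSpace F E)) k₀ ↔
      ContinuousAt (fun k => (trivializationAt F E (σ k₀)).linearMapAt ℝ (σ k) (h k)) k₀ := by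
  rw [FiberBundle.continuousAt_totalSpace]
  simp only [hσ.continuousAt, true_and]
  refine continuousAt_congr ?_
  have : ∀ᶠ k in 𝓝 k₀, σ k ∈ (trivializationAt F E (σ k₀)).baseSet :=
    hσ.continuousAt ((trivializationAt F E (σ k₀)).open_baseSet.mem_nhds
      (mem_baseSet_trivializationAt F E _))
  filter_upwards [this] with k hk
  rw [Trivialization.coe_linearMapAt_of_mem _ hk]

variable (F) in
lemma continuous_lift_zero (hσ : Continuous σ) :
    Continuous fun k => (⟨σ k, 0⟩ : TotalSpace F E) :=
  continuous_iff_continuousAt.2 fun k₀ => by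
    rw [continuousAt_lift_iff hσ]
    simpa using continuousAt_const

lemma continuousAt_lift_add (hσ : Continuous σ) {h h' : ∀ k, E (σ k)} {k₀ : K}
    (hh : ContinuousAt (fun k => (⟨σ k, h k⟩ : TotalSpace F E)) k₀)
    (hh' : ContinuousAt (fun k => (⟨σ k, h' k⟩ : TotalSpace F E)) k₀) :
    ContinuousAt (fun k => (⟨σ k, h k + h' k⟩ : TotalSpace F E)) k₀ := by
  rw [continuousAt_lift_iff hσ] at *
  simp only [map_add]
  exact hh.add hh'

lemma continuousAt_lift_smul (hσ : Continuous σ) {h : ∀ k, E (σ k)} {a : K → ℝ} {k₀ : K}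
    (ha : ContinuousAt a k₀)
    (hh : ContinuousAt (fun k => (⟨σ k, h k⟩ : TotalSpace F E)) k₀) :
    ContinuousAt (fun k => (⟨σ k, a k • h k⟩ : TotalSpace F E)) k₀ := by
  rw [continuousAt_lift_iff hσ] at *
  simp only [map_smul]
  exact ha.smul hh

lemma continuousAt_lift_sum (hσ : Continuous σ) {ι : Type*} (s : Finset ι)
    {h : ι → ∀ k, E (σ k)} {k₀ : K}
    (hh : ∀ i ∈ s, ContinuousAt (fun k => (⟨σ k, h i k⟩ : TotalSpace F E)) k₀) :
    ContinuousAt (fun k => (⟨σ k, ∑ i ∈ s, h i k⟩ : TotalSpace F E)) k₀ := by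
  classical
  induction s using Finset.induction_on with
  | empty => simpa using (continuous_lift_zero F hσ).continuousAt
  | insert i s hi ih =>
    simp only [Finset.sum_insert hi]
    exact continuousAt_lift_add hσ (hh i (by simp)) (ih fun j hj => hh j (by simp [hj]))

variable {J : ∀ x, E x →ₗ[ℝ] E x} {V : ∀ x, Submodule ℝ (E x)} {r : ℕ}

lemma continuousAt_lift_complexComb (hJc : Continuous fun p : TotalSpace F E =>
      (⟨p.1, J p.1 p.2⟩ : TotalSpace F E)) (hσ : Continuous σ) {g : Fin r → ∀ k, E (σ k)} {k₀ : K}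
    (hg : ∀ i, ContinuousAt (fun k => (⟨σ k, g i k⟩ : TotalSpace F E)) k₀)
    {c : K → Fin r → ℂ} (hc : ∀ i, ContinuousAt (fun k => c k i) k₀) :
    ContinuousAt (fun k => (⟨σ k, complexComb (J (σ k)) (fun i => g i k) (c k)⟩ :
      TotalSpace F E)) k₀ :=
  continuousAt_lift_sum hσ _ fun i _ => continuousAt_lift_add hσ
    (continuousAt_lift_smul hσ (Complex.continuous_re.continuousAt.comp (hc i)) (hg i))
    (continuousAt_lift_smul hσ (Complex.continuous_im.continuousAt.comp (hc i))
      (continuousAt_lift_J hJc (hg i)))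

variable [FiniteDimensional ℝ F]

lemma continuousAt_coords (hJc : Continuous fun p : TotalSpace F E =>
      (⟨p.1, J p.1 p.2⟩ : TotalSpace F E)) (hσ : Continuous σ) {g : Fin r → ∀ k, E (σ k)} {k₀ : K}
    (hg : ∀ i, ContinuousAt (fun k => (⟨σ k, g i k⟩ : TotalSpace F E)) k₀)
    (hbasis : IsComplexBasis (J (σ k₀)) (V (σ k₀)) fun i => g i k₀) {c : K → Fin r → ℂ}
    (h : ContinuousAt (fun k => (⟨σ k, complexComb (J (σ k)) (fun i => g i k) (c k)⟩ :
      TotalSpace F E)) k₀) :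
    ContinuousAt c k₀ := by
  -- In the trivialization at σ k₀ the frame becomes a family of real linear maps `L k` into the
  -- fixed space F, injective at k₀.
  set e := trivializationAt F E (σ k₀)
  let G : K → Fin r → F := fun k i => e.linearMapAt ℝ (σ k) (g i k)
  let G' : K → Fin r → F := fun k i => e.linearMapAt ℝ (σ k) (J (σ k) (g i k))
  let L : K → (Fin r → ℂ) →L[ℝ] F := fun k => ∑ i,
    (((Complex.reCLM.comp (ContinuousLinearMap.proj i)).smulRight (G k i)) +
      ((Complex.imCLM.comp (ContinuousLinearMap.proj i)).smulRight (G' k i)))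
  have hLapp : ∀ k c, L k c = e.linearMapAt ℝ (σ k) (complexComb (J (σ k)) (fun i => g i k) c) := by
    intro k c
    simp only [L, complexComb, map_sum, map_add, map_smul, sum_apply]
    rfl
  have hG : ∀ i, ContinuousAt (fun k => G k i) k₀ := fun i =>
    (continuousAt_lift_iff hσ _ _).1 (hg i)
  have hG' : ∀ i, ContinuousAt (fun k => G' k i) k₀ := fun i =>
    (continuousAt_lift_iff hσ _ _).1 (continuousAt_lift_J hJc (hg i))
  have hL : ContinuousAt L k₀ := by
    refine tendsto_finsetSum _ fun i _ => ?_
    exact ((ContinuousLinearMap.smulRightL ℝ (Fin r → ℂ) F _).continuous.continuousAt.comp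
      (hG i)).add ((ContinuousLinearMap.smulRightL ℝ (Fin r → ℂ) F _).continuous.continuousAt.comp
      (hG' i))
  refine continuousAt_of_continuousAt_complexComb hL ?_ ?_
  · intro c d hcd
    rw [hLapp, hLapp] at hcd
    refine hbasis.1 ?_
    have hb : σ k₀ ∈ e.baseSet := mem_baseSet_trivializationAt F E _
    rw [← e.symm_linearMapAt (R := ℝ) hb (complexComb _ _ c), hcd, e.symm_linearMapAt hb]
  · simp only [hLapp]
    exact (continuousAt_lift_iff hσ _ _).1 h

lemma IsFrameAlong.continuous_changeDet (hJc : Continuous fun p : TotalSpace F E =>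
      (⟨p.1, J p.1 p.2⟩ : TotalSpace F E)) (hσ : Continuous σ) {g f : Fin r → ∀ k, E (σ k)}
    (hg : IsFrameAlong F J V σ g) (hf : IsFrameAlong F J V σ f) :
    Continuous fun k => changeDet (J (σ k)) (fun i => g i k) (fun i => f i k) := by
  refine Continuous.matrix_det (continuous_matrix fun i j => ?_)
  have : Continuous fun k => coords (J (σ k)) (fun i => g i k) (f j k) := by
    rw [continuous_iff_continuousAt]
    intro k₀
    refine continuousAt_coords hJc hσ (fun i => (hg.continuous i).continuousAt) (hg.basis k₀) ?_
    refine (hf.continuous j).continuousAt.congr (Eventually.of_forall fun k => ?_)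
    simp only [(hg.basis k).coords_spec ((hf.basis k).mem_apply j)]
  exact (continuous_apply i).comp this

end Continuity


/-! ### The obstruction cocycle -/

section Obstruction

variable {X : Type*} [TopologicalSpace X] {F : Type*} {E : X → Type*}
  [∀ x, AddCommMonoid (E x)] [∀ x, Module ℝ (E x)] [TopologicalSpace (TotalSpace F E)]
  {J : ∀ x, E x →ₗ[ℝ] E x} {V : ∀ x, Submodule ℝ (E x)} {r : ℕ} {A : Set X}
  {s : Fin r → ∀ x : A, E x}

variable (F J V r) in
/-- `J` is a continuous complex structure and `V` has a complex frame along every singular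
simplex. -/
structure HasSimplexFrames : Prop where
  sq : ∀ x v, J x (J x v) = (-1 : ℝ) • v
  continuous_J : Continuous fun p : TotalSpace F E => (⟨p.1, J p.1 p.2⟩ : TotalSpace F E)
  exists_frame : ∀ (n : ℕ) (σ : C(Simplex n, X)),
    ∃ g : Fin r → ∀ p, E (σ p), IsFrameAlong F J V σ g

/-- The determinant of the chosen frame along the path `T ∘ ρ` with respect to a frame `G`
along `T`. -/
def SkeletonFrame.edgeDet (Φ : SkeletonFrame F J V A s) {K : Type*} [TopologicalSpace K]
    (T : C(K, X)) (G : Fin r → ∀ p, E (T p)) (ρ : C(Simplex 1, K)) (t : Simplex 1) : ℂ :=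
  changeDet (J (T (ρ t))) (fun i => G i (ρ t)) (fun i => Φ.edge (T.comp ρ) i t)

/-- The determinant of the chosen bases at the points of `T` with respect to a frame `G`. -/
def SkeletonFrame.vertexDet (Φ : SkeletonFrame F J V A s) {K : Type*} [TopologicalSpace K]
    (T : C(K, X)) (G : Fin r → ∀ p, E (T p)) (p : K) : ℂ :=
  changeDet (J (T p)) (fun i => G i p) (Φ.vertex (T p))

lemma SkeletonFrame.edgeDet_vertex (Φ : SkeletonFrame F J V A s) {K : Type*} [TopologicalSpace K]
    (T : C(K, X)) (G : Fin r → ∀ p, E (T p)) (ρ : C(Simplex 1, K)) (m : Fin 2) :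
    Φ.edgeDet T G ρ (stdSimplex.vertex m) = Φ.vertexDet T G (ρ (stdSimplex.vertex m)) := by
  have : (fun i => Φ.edge (T.comp ρ) i (stdSimplex.vertex m)) =
      Φ.vertex ((T.comp ρ) (stdSimplex.vertex m)) := funext fun i => Φ.edge_end _ m i
  simp only [edgeDet, this]
  rfl

/-- Since g is a basis, the matrices in the definition are forced, and their determinants are those
of `edgeDet`. -/
lemma isObstruction_iff (Φ : SkeletonFrame F J V A s) (σ : C(Simplex 2, X)) (n : ℤ) :
    IsObstruction Φ σ n ↔ ∃ g : Fin r → ∀ p, E (σ p), IsFrameAlong F J V σ g ∧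
      ∃ z : Fin 3 → ℂ, (∀ k, IsLogVariation (Φ.edgeDet σ g (face k)) (z k)) ∧
        z 2 + z 0 - z 1 = 2 * Real.pi * Complex.I * n := by
  constructor
  · rintro ⟨g, hg, N, z, hN, hz, h⟩
    refine ⟨g, hg, z, fun k => ?_, h⟩
    convert hz k using 2 with t
    exact (hg.basis _).changeDet_eq fun j => hN k t j
  · rintro ⟨g, hg, z, hz, h⟩
    refine ⟨g, hg, fun k t => changeMatrix (J (σ (face k t))) (fun i => g i (face k t))
      (fun i => Φ.edge (σ.comp (face k)) i t), z, fun k t j => ?_, hz, h⟩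
    exact (hg.basis _).changeMatrix_spec
      (fun j => ((Φ.edge_frame (σ.comp (face k))).basis t).mem_apply j) j

lemma SkeletonFrame.vertexDet_ne_zero (hV : HasSimplexFrames F J V r)
    (Φ : SkeletonFrame F J V A s) {K : Type*} [TopologicalSpace K] {T : C(K, X)}
    {G : Fin r → ∀ p, E (T p)} (hG : IsFrameAlong F J V T G) (p : K) :
    Φ.vertexDet T G p ≠ 0 :=
  (hG.basis p).changeDet_ne_zero (hV.sq _) (Φ.vertex_basis (T p))

/-- Edge frames restrict to the vertex bases at their ends, so the three determinants close up to a
loop. -/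
lemma SkeletonFrame.exp_boundary (hV : HasSimplexFrames F J V r) (Φ : SkeletonFrame F J V A s)
    {σ : C(Simplex 2, X)} {g : Fin r → ∀ p, E (σ p)} (hg : IsFrameAlong F J V σ g) {z : Fin 3 → ℂ}
    (hz : ∀ k, IsLogVariation (Φ.edgeDet σ g (face k)) (z k)) :
    Complex.exp (z 2 + z 0 - z 1) = 1 := by
  have h : ∀ k : Fin 3, Φ.vertexDet σ g (stdSimplex.vertex (k.succAbove 1)) =
      Complex.exp (z k) * Φ.vertexDet σ g (stdSimplex.vertex (k.succAbove 0)) := fun k => by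
    have := (hz k).exp_eq
    rwa [Φ.edgeDet_vertex, Φ.edgeDet_vertex, face_vertex, face_vertex] at this
  have h0 : Φ.vertexDet σ g (stdSimplex.vertex 2) =
    Complex.exp (z 0) * Φ.vertexDet σ g (stdSimplex.vertex 1) := h 0
  have h1 : Φ.vertexDet σ g (stdSimplex.vertex 2) =
    Complex.exp (z 1) * Φ.vertexDet σ g (stdSimplex.vertex 0) := h 1
  have h2 : Φ.vertexDet σ g (stdSimplex.vertex 1) =
    Complex.exp (z 2) * Φ.vertexDet σ g (stdSimplex.vertex 0) := h 2
  rw [Complex.exp_sub, Complex.exp_add, div_eq_one_iff_eq (Complex.exp_ne_zero _)]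
  refine mul_right_cancel₀ (Φ.vertexDet_ne_zero hV hg (stdSimplex.vertex 0)) ?_
  rw [← h1, h0, h2]
  ring

lemma SkeletonFrame.edge_comp_eq (Φ : SkeletonFrame F J V A s) {K : Type*}
    [TopologicalSpace K] {T : C(K, X)} (hT : range T ⊆ A) (ρ : C(Simplex 1, K)) (t : Simplex 1) :
    (fun i => Φ.edge (T.comp ρ) i t) = fun i => s i ⟨T (ρ t), hT (mem_range_self _)⟩ :=
  funext fun i => Φ.edge_eq (T.comp ρ) ((range_comp_subset_range ρ T).trans hT) i t

/-- A logarithm defined over the whole triangle has variation zero around its boundary. -/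
lemma sum_log_boundary (θ : C(Simplex 2, ℂ)) :
    (θ (face 2 (stdSimplex.vertex 1)) - θ (face 2 (stdSimplex.vertex 0))) +
      (θ (face 0 (stdSimplex.vertex 1)) - θ (face 0 (stdSimplex.vertex 0))) -
      (θ (face 1 (stdSimplex.vertex 1)) - θ (face 1 (stdSimplex.vertex 0))) = 0 := by
  simp only [face_vertex]
  rw [show (2 : Fin 3).succAbove 1 = 1 from rfl, show (2 : Fin 3).succAbove 0 = 0 from rfl,
    show (0 : Fin 3).succAbove 1 = 2 from rfl, show (0 : Fin 3).succAbove 0 = 1 from rfl,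
    show (1 : Fin 3).succAbove 1 = 2 from rfl, show (1 : Fin 3).succAbove 0 = 0 from rfl]
  ring

end Obstruction

/-! ### Existence, cocycle condition and independence of choices for the obstruction class. -/

section WellDefined

variable {X : Type*} [TopologicalSpace X] {F : Type*} {E : X → Type*}
  [NormedAddCommGroup F] [NormedSpace ℝ F] [FiniteDimensional ℝ F]
  [∀ x, AddCommMonoid (E x)] [∀ x, Module ℝ (E x)] [TopologicalSpace (TotalSpace F E)]
  [∀ x, TopologicalSpace (E x)] [FiberBundle F E] [VectorBundle ℝ F E]
  {J : ∀ x, E x →ₗ[ℝ] E x} {V : ∀ x, Submodule ℝ (E x)} {r : ℕ} {A : Set X}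
  {s : Fin r → ∀ x : A, E x}

lemma SkeletonFrame.exists_edgeDet_log (hV : HasSimplexFrames F J V r)
    (Φ : SkeletonFrame F J V A s) {K : Type*} [TopologicalSpace K] {T : C(K, X)}
    {G : Fin r → ∀ p, E (T p)} (hG : IsFrameAlong F J V T G) (ρ : C(Simplex 1, K)) :
    ∃ z, IsLogVariation (Φ.edgeDet T G ρ) z := by
  have hG' : IsFrameAlong F J V (T.comp ρ) fun i t => G i (ρ t) := hG.comp ρ.continuous
  exact exists_isLogVariation
    (hG'.continuous_changeDet hV.continuous_J (T.comp ρ).continuous (Φ.edge_frame _))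
    fun t => (hG'.basis t).changeDet_ne_zero (hV.sq _) ((Φ.edge_frame _).basis t)

lemma exists_isObstruction (hV : HasSimplexFrames F J V r) (Φ : SkeletonFrame F J V A s)
    (σ : C(Simplex 2, X)) : ∃ n, IsObstruction Φ σ n := by
  obtain ⟨g, hg⟩ := hV.exists_frame 2 σ
  choose z hz using fun k : Fin 3 => Φ.exists_edgeDet_log hV hg (face k)
  obtain ⟨n, hn⟩ := exists_int_of_exp_eq_one (Φ.exp_boundary hV hg hz)
  exact ⟨n, (isObstruction_iff Φ σ n).2 ⟨g, hg, z, hz, hn⟩⟩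

/-- The winding number may be computed in any reference frame: the determinant between two of them
has a logarithm on all of the simplex, so `sum_log_boundary` applies. -/
lemma IsObstruction.eq_boundary (hV : HasSimplexFrames F J V r) {Φ : SkeletonFrame F J V A s}
    {σ : C(Simplex 2, X)} {n : ℤ} (h : IsObstruction Φ σ n) {g : Fin r → ∀ p, E (σ p)}
    (hg : IsFrameAlong F J V σ g) {z : Fin 3 → ℂ}
    (hz : ∀ k, IsLogVariation (Φ.edgeDet σ g (face k)) (z k)) :
    z 2 + z 0 - z 1 = 2 * Real.pi * Complex.I * n := by
  obtain ⟨g', hg', z', hz', h⟩ := (isObstruction_iff Φ σ n).1 h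
  obtain ⟨θ, hθ⟩ := exists_log (hg.continuous_changeDet hV.continuous_J σ.continuous hg')
    fun p => (hg.basis p).changeDet_ne_zero (hV.sq _) (hg'.basis p)
  have key : ∀ k, z k = (θ (face k (stdSimplex.vertex 1)) - θ (face k (stdSimplex.vertex 0))) +
      z' k := fun k => by
    have h1 : IsLogVariation (fun t => changeDet (J (σ (face k t))) (fun i => g i (face k t))
        (fun i => g' i (face k t)))
        (θ (face k (stdSimplex.vertex 1)) - θ (face k (stdSimplex.vertex 0))) :=
      ⟨θ.comp (face k), fun t => hθ (face k t), rfl⟩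
    refine (hz k).unique ?_
    convert h1.mul (hz' k) using 2 with t
    exact (hg.basis _).changeDet_mul (hV.sq _) (hg'.basis _)
      fun j => ((Φ.edge_frame (σ.comp (face k))).basis t).mem_apply j
  rw [← h, key, key, key]
  linear_combination sum_log_boundary θ

lemma IsObstruction.unique (hV : HasSimplexFrames F J V r) {Φ : SkeletonFrame F J V A s}
    {σ : C(Simplex 2, X)} {n n' : ℤ} (h : IsObstruction Φ σ n) (h' : IsObstruction Φ σ n') :
    n = n' := by
  obtain ⟨g, hg, z, hz, hn⟩ := (isObstruction_iff Φ σ n').1 h'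
  exact int_eq_of_two_pi_I_mul ((h.eq_boundary hV hg hz).symm.trans hn)

/-- Measured in one frame over the whole tetrahedron, each edge occurs in two faces, and its two
contributions to the alternating sum cancel. -/
lemma IsObstruction.coboundary_eq_zero (hV : HasSimplexFrames F J V r)
    {Φ : SkeletonFrame F J V A s} {c : Cochain X 2} (hc : ∀ σ, IsObstruction Φ σ (c σ)) :
    coboundary X 2 c = 0 := by
  ext T
  obtain ⟨G, hG⟩ := hV.exists_frame 3 T
  -- The variation is chosen once per ordered pair of vertices, so two faces with a common edge use
  -- the same number.
  choose w hw using fun h : Fin 2 → Fin 4 =>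
    Φ.exists_edgeDet_log hV hG ⟨stdSimplex.map h, stdSimplex.continuous_map h⟩
  have key : ∀ k : Fin 4, w (k.succAbove ∘ Fin.succAbove 2) + w (k.succAbove ∘ Fin.succAbove 0) -
      w (k.succAbove ∘ Fin.succAbove 1) = 2 * Real.pi * Complex.I * c (T.comp (face k)) := by
    intro k
    have hGk : IsFrameAlong F J V (T.comp (face k)) fun i p => G i (face k p) :=
      hG.comp (face k).continuous
    refine (hc (T.comp (face k))).eq_boundary hV hGk
      (z := fun l => w (k.succAbove ∘ l.succAbove)) fun l => ?_
    have := hw (k.succAbove ∘ l.succAbove)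
    rw [← face_apply_face] at this
    exact this
  have h0 := key 0
  have h1 := key 1
  have h2 := key 2
  have h3 := key 3
  rw [show (0 : Fin 4).succAbove ∘ Fin.succAbove 2 = ![1, 2] by decide,
    show (0 : Fin 4).succAbove ∘ Fin.succAbove 0 = ![2, 3] by decide,
    show (0 : Fin 4).succAbove ∘ Fin.succAbove 1 = ![1, 3] by decide] at h0
  rw [show (1 : Fin 4).succAbove ∘ Fin.succAbove 2 = ![0, 2] by decide,
    show (1 : Fin 4).succAbove ∘ Fin.succAbove 0 = ![2, 3] by decide,
    show (1 : Fin 4).succAbove ∘ Fin.succAbove 1 = ![0, 3] by decide] at h1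
  rw [show (2 : Fin 4).succAbove ∘ Fin.succAbove 2 = ![0, 1] by decide,
    show (2 : Fin 4).succAbove ∘ Fin.succAbove 0 = ![1, 3] by decide,
    show (2 : Fin 4).succAbove ∘ Fin.succAbove 1 = ![0, 3] by decide] at h2
  rw [show (3 : Fin 4).succAbove ∘ Fin.succAbove 2 = ![0, 1] by decide,
    show (3 : Fin 4).succAbove ∘ Fin.succAbove 0 = ![1, 2] by decide,
    show (3 : Fin 4).succAbove ∘ Fin.succAbove 1 = ![0, 2] by decide] at h3
  have hsum : coboundary X 2 c T = c (T.comp (face 0)) - c (T.comp (face 1)) +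
      c (T.comp (face 2)) - c (T.comp (face 3)) := by
    change ∑ k : Fin 4, (-1) ^ (k : ℕ) * c (T.comp (face k)) = _
    rw [Fin.sum_univ_four]
    simp
    ring
  rw [hsum]
  refine int_eq_of_two_pi_I_mul ?_
  push_cast
  simp only [Pi.zero_apply, Int.cast_zero]
  linear_combination h1 + h3 - h0 - h2

/-- Inside A the frame s itself serves as reference frame, and the three determinants are constantly
1. -/
lemma IsObstruction.eq_zero_of_subset (hV : HasSimplexFrames F J V r)
    (hs : IsFrameAlong F J V (fun x : A => (x : X)) s) {Φ : SkeletonFrame F J V A s}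
    {σ : C(Simplex 2, X)} {n : ℤ} (h : IsObstruction Φ σ n) (hσ : range σ ⊆ A) : n = 0 := by
  have hg : IsFrameAlong F J V σ fun i p => s i ⟨σ p, hσ (mem_range_self p)⟩ :=
    hs.comp (ρ := fun p => (⟨σ p, hσ (mem_range_self p)⟩ : A)) (by fun_prop)
  have := h.eq_boundary hV hg (z := fun _ => 0) fun k => by
    convert IsLogVariation.one using 1
    ext t
    rw [SkeletonFrame.edgeDet, Φ.edge_comp_eq hσ]
    exact (hg.basis _).changeDet_self
  refine int_eq_of_two_pi_I_mul (this.symm.trans ?_)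
  simp

lemma obstruction_mem_relCocycles (hV : HasSimplexFrames F J V r)
    (hs : IsFrameAlong F J V (fun x : A => (x : X)) s) {Φ : SkeletonFrame F J V A s}
    {c : Cochain X 2} (hc : ∀ σ, IsObstruction Φ σ (c σ)) : c ∈ relCocycles A 2 :=
  ⟨fun σ hσ => (hc σ).eq_zero_of_subset hV hs hσ, IsObstruction.coboundary_eq_zero hV hc⟩

/-- The bounding cochain counts the turns, along each edge, of the determinant between the two
frames. A correction by vertex logarithms makes this count an integer, and the corrections cancel
around a triangle. -/
lemma obstruction_sub_mem_relCoboundaries (hV : HasSimplexFrames F J V r)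
    {Φ Φ' : SkeletonFrame F J V A s}
    {c c' : Cochain X 2} (hc : ∀ σ, IsObstruction Φ σ (c σ))
    (hc' : ∀ σ, IsObstruction Φ' σ (c' σ)) : c' - c ∈ relCoboundaries A 2 := by
  classical
  let d : X → ℂ := fun x => changeDet (J x) (Φ.vertex x) (Φ'.vertex x)
  have hd : ∀ x, d x ≠ 0 := fun x =>
    (Φ.vertex_basis x).changeDet_ne_zero (hV.sq x) (Φ'.vertex_basis x)
  -- No continuity in x is needed: one logarithm per vertex suffices. The principal branch gives 0
  -- on A, where both frames agree.
  let ℓ : X → ℂ := fun x => Complex.log (d x)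
  have hℓ : ∀ x, Complex.exp (ℓ x) = d x := fun x => Complex.exp_log (hd x)
  have hℓA : ∀ x ∈ A, ℓ x = 0 := fun x hx => by
    have h1 : Φ'.vertex x = Φ.vertex x := by
      ext i; rw [Φ.vertex_eq x hx, Φ'.vertex_eq x hx]
    simp only [ℓ, d, h1, (Φ.vertex_basis x).changeDet_self, Complex.log_one]
  let D : C(Simplex 1, X) → Simplex 1 → ℂ := fun e t =>
    changeDet (J (e t)) (fun i => Φ.edge e i t) (fun i => Φ'.edge e i t)
  have hDend : ∀ e m, D e (stdSimplex.vertex m) = d (e (stdSimplex.vertex m)) := fun e m => by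
    simp only [D, d, Φ.edge_end, Φ'.edge_end]
  have hD : ∀ e, ∃ b : ℤ, IsLogVariation (D e) (2 * Real.pi * Complex.I * b +
      (ℓ (e (stdSimplex.vertex 1)) - ℓ (e (stdSimplex.vertex 0)))) := fun e => by
    obtain ⟨z, hz⟩ := exists_isLogVariation
      ((Φ.edge_frame e).continuous_changeDet hV.continuous_J e.continuous (Φ'.edge_frame e))
      fun t => ((Φ.edge_frame e).basis t).changeDet_ne_zero (hV.sq _) ((Φ'.edge_frame e).basis t)
    obtain ⟨b, hb⟩ := exists_int_of_exp_eq_one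
      (z := z - (ℓ (e (stdSimplex.vertex 1)) - ℓ (e (stdSimplex.vertex 0)))) (by
        have h := hz.exp_eq
        change D e _ = _ * D e _ at h
        rw [hDend, hDend] at h
        rw [Complex.exp_sub, Complex.exp_sub, hℓ, hℓ, h]
        have := hd (e (stdSimplex.vertex 0))
        have := Complex.exp_ne_zero z
        field_simp)
    refine ⟨b, ?_⟩
    rw [← hb, sub_add_cancel]
    exact hz
  choose b hb using hD
  refine ⟨b, fun e he => ?_, ?_⟩
  · have h1 : D e = fun _ => 1 := by
      ext t
      have : (fun i => Φ'.edge e i t) = fun i => Φ.edge e i t := by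
        ext i; rw [Φ.edge_eq e he, Φ'.edge_eq e he]
      simp only [D, this]
      exact ((Φ.edge_frame e).basis t).changeDet_self
    have h2 := hb e
    rw [h1, hℓA _ (he (mem_range_self _)), hℓA _ (he (mem_range_self _))] at h2
    refine int_eq_of_two_pi_I_mul ?_
    have := h2.unique IsLogVariation.one
    simpa using this
  · ext σ
    obtain ⟨g, hg⟩ := hV.exists_frame 2 σ
    choose z hz using fun k : Fin 3 => Φ.exists_edgeDet_log hV hg (face k)
    have h1 := (hc σ).eq_boundary hV hg hz
    have h2 := (hc' σ).eq_boundary hV hg (z := fun k => z k +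
        (2 * Real.pi * Complex.I * b (σ.comp (face k)) +
          (ℓ (σ (face k (stdSimplex.vertex 1))) - ℓ (σ (face k (stdSimplex.vertex 0)))))) fun k => by
      convert (hz k).mul (hb (σ.comp (face k))) using 2 with t
      · exact (hg.basis _).changeDet_mul (hV.sq _) ((Φ.edge_frame (σ.comp (face k))).basis t)
          fun j => ((Φ'.edge_frame (σ.comp (face k))).basis t).mem_apply j
      · rfl
    have hsum : coboundary X 1 b σ = b (σ.comp (face 0)) - b (σ.comp (face 1)) +
        b (σ.comp (face 2)) := by
      change ∑ k : Fin 3, (-1) ^ (k : ℕ) * b (σ.comp (face k)) = _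
      rw [Fin.sum_univ_three]
      simp
      ring
    rw [hsum, Pi.sub_apply]
    refine int_eq_of_two_pi_I_mul ?_
    push_cast
    simp only [face_vertex] at h2
    rw [show (2 : Fin 3).succAbove 1 = 1 from rfl, show (2 : Fin 3).succAbove 0 = 0 from rfl,
      show (0 : Fin 3).succAbove 1 = 2 from rfl, show (0 : Fin 3).succAbove 0 = 1 from rfl,
      show (1 : Fin 3).succAbove 1 = 2 from rfl, show (1 : Fin 3).succAbove 0 = 0 from rfl] at h2
    linear_combination h2 - h1

/-- The relative first Chern class is well defined as soon as there is a frame on the singular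
1-skeleton. -/
theorem existsUnique_isRelChernClass (hV : HasSimplexFrames F J V r)
    (hs : IsFrameAlong F J V (fun x : A => (x : X)) s) (Φ : SkeletonFrame F J V A s) :
    ∃! z, IsRelChernClass F J V A s z := by
  choose c hc using exists_isObstruction hV Φ
  refine ⟨QuotientAddGroup.mk ⟨c, obstruction_mem_relCocycles hV hs hc⟩, ⟨Φ, _, hc, rfl⟩, ?_⟩
  rintro _ ⟨Φ', c', hc', rfl⟩
  refine (QuotientAddGroup.eq.2 ?_).symm
  rw [AddSubgroup.mem_addSubgroupOf]
  have := obstruction_sub_mem_relCoboundaries hV hc hc'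
  rw [sub_eq_neg_add] at this
  exact this

end WellDefined


/-! ### Complex line bundles over simplices -/

section Projections

open Filter Topology

/-- A continuous family of nonzero projections on a compact contractible space has a continuous
nowhere zero family of fixed vectors. -/
lemma exists_continuous_fixed_vector {K : Type*} [MetricSpace K] [CompactSpace K]
    [ContractibleSpace K] {H : Type*} [NormedAddCommGroup H] [NormedSpace ℂ H]
    {Q : K → H →L[ℂ] H} (hQ : Continuous Q) (hid : ∀ k v, Q k (Q k v) = Q k v)
    (hne : ∀ k, Q k ≠ 0) : ∃ v : K → H, Continuous v ∧ ∀ k, v k ≠ 0 ∧ Q k (v k) = v k := by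
  obtain ⟨y, ⟨G⟩⟩ := id_nullhomotopic K
  -- The contraction runs from the constant y at time 0 to the identity at time 1. `projIcc` extends
  -- it to all real times, so the induction needs no bound on i.
  let c : ℝ → K → K := fun t k => G (unitInterval.symm (projIcc 0 1 zero_le_one t), k)
  have hc : ∀ t, Continuous (c t) := fun t => by fun_prop
  have hc0 : ∀ k, c 0 k = y := fun k => by simp [c]
  have hc1 : ∀ k, c 1 k = k := fun k => by simp [c]
  have huc : UniformContinuous fun p : unitInterval × K => Q (G p) :=
    CompactSpace.uniformContinuous_of_continuous (by fun_prop)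
  obtain ⟨δ, hδ, h⟩ := Metric.uniformContinuous_iff.1 huc 1 one_pos
  -- With m + 1 time steps, each shorter than δ, consecutive projections are at distance less than
  -- 1.
  obtain ⟨m, hm⟩ := exists_nat_one_div_lt hδ
  have hm0 : (0 : ℝ) < m + 1 := by positivity
  have hstep : ∀ (i : ℕ) (k : K), ‖Q (c (i / (m + 1)) k) - Q (c ((i + 1 : ℕ) / (m + 1)) k)‖ < 1 := by
    intro i k
    rw [← dist_eq_norm]
    refine h (lt_of_le_of_lt ?_ hm)
    rw [Prod.dist_eq, dist_self, max_eq_left dist_nonneg]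
    have h1 : ∀ a b : unitInterval, dist (unitInterval.symm a) (unitInterval.symm b) =
        dist a b := fun a b => by
      simp only [Subtype.dist_eq, unitInterval.coe_symm_eq, Real.dist_eq]
      rw [show 1 - (a : ℝ) - (1 - b) = -(a - b) by ring, abs_neg]
    rw [h1]
    refine (LipschitzWith.projIcc zero_le_one).dist_le_mul _ _ |>.trans ?_
    rw [NNReal.coe_one, one_mul, Real.dist_eq, ← sub_div, abs_div, abs_of_pos hm0]
    push_cast
    simp
  obtain ⟨w, hw⟩ : ∃ w, Q y w ≠ 0 := by
    by_contra! hw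
    exact hne y (ContinuousLinearMap.ext hw)
  have hind : ∀ i : ℕ, ∃ v : K → H, Continuous v ∧
      ∀ k, v k ≠ 0 ∧ Q (c (i / (m + 1)) k) (v k) = v k := by
    intro i
    induction i with
    | zero =>
      refine ⟨fun _ => Q y w, continuous_const, fun k => ⟨hw, ?_⟩⟩
      simp [hc0, hid]
    | succ i ih =>
      obtain ⟨v, hv, hv'⟩ := ih
      -- The next projection is applied to the previous vector. If it killed v k, then v k would
      -- equal the difference of the two projections applied to v k, which has smaller norm.
      refine ⟨fun k => Q (c ((i + 1 : ℕ) / (m + 1)) k) (v k),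
        (hQ.comp (hc _)).clm_apply hv, fun k => ⟨fun h0 => ?_, hid _ _⟩⟩
      replace h0 : Q (c ((i + 1 : ℕ) / (m + 1)) k) (v k) = 0 := h0
      have h1 : ‖v k‖ ≤ ‖Q (c (i / (m + 1)) k) - Q (c ((i + 1 : ℕ) / (m + 1)) k)‖ * ‖v k‖ := by
        refine le_trans (le_of_eq ?_) (ContinuousLinearMap.le_opNorm _ _)
        rw [sub_apply, h0, sub_zero, (hv' k).2]
      have h2 := norm_pos_iff.2 (hv' k).1
      nlinarith [hstep i k]
  obtain ⟨v, hv, hv'⟩ := hind (m + 1)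
  refine ⟨v, hv, fun k => ?_⟩
  have := hv' k
  rwa [show ((m + 1 : ℕ) : ℝ) / (m + 1) = 1 by push_cast; exact div_self hm0.ne', hc1] at this

open ComplexConjugate in
/-- The orthogonal projection of `ℂᴺ` onto the line of the complex conjugate of `a`. -/
def conjProj {N : ℕ} (a : Fin N → ℂ) : (Fin N → ℂ) →L[ℂ] (Fin N → ℂ) :=
  (∑ l, conj (a l) * a l)⁻¹ •
    ∑ j, (ContinuousLinearMap.proj j).smulRight (a j • fun i => conj (a i))

open ComplexConjugate in
lemma conjProj_apply {N : ℕ} (a v : Fin N → ℂ) :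
    conjProj a v = ((∑ l, conj (a l) * a l)⁻¹ * ∑ j, a j * v j) • fun i => conj (a i) := by
  simp only [conjProj, smul_apply, sum_apply,
    ContinuousLinearMap.smulRight_apply, ContinuousLinearMap.proj_apply, mul_smul, Finset.sum_smul]
  congr 1
  exact Finset.sum_congr rfl fun j _ => smul_comm _ _ _

open ComplexConjugate in
lemma sum_conj_mul_self_ne_zero {N : ℕ} {a : Fin N → ℂ} (ha : a ≠ 0) :
    ∑ l, conj (a l) * a l ≠ 0 := by
  have h : ∑ l, conj (a l) * a l = ((∑ l, ‖a l‖ ^ 2 : ℝ) : ℂ) := by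
    push_cast
    exact Finset.sum_congr rfl fun l _ => Complex.conj_mul' _
  rw [h]
  norm_cast
  intro h0
  apply ha
  rw [Finset.sum_eq_zero_iff_of_nonneg fun _ _ => by positivity] at h0
  ext l
  simpa using h0 l (Finset.mem_univ l)

/-- The projection depends only on the line spanned by a, so it can vary continuously although a is
known only up to a scalar. -/
lemma conjProj_smul {N : ℕ} (a : Fin N → ℂ) {μ : ℂ} (hμ : μ ≠ 0) :
    conjProj (μ • a) = conjProj a := by
  ext v i
  have h2 : (starRingEnd ℂ) μ ≠ 0 := by simpa using hμ
  have e1 : ∑ l, (starRingEnd ℂ) ((μ • a) l) * (μ • a) l =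
      (starRingEnd ℂ) μ * μ * ∑ l, (starRingEnd ℂ) (a l) * a l := by
    rw [Finset.mul_sum]
    exact Finset.sum_congr rfl fun l _ => by simp; ring
  have e2 : ∑ j, (μ • a) j * v j = μ * ∑ j, a j * v j := by
    rw [Finset.mul_sum]
    exact Finset.sum_congr rfl fun l _ => by simp; ring
  have e3 : (starRingEnd ℂ) ((μ • a) i) = (starRingEnd ℂ) μ * (starRingEnd ℂ) (a i) := by simp
  have e4 : ∀ b : Fin N → ℂ, conjProj b v i = (∑ l, (starRingEnd ℂ) (b l) * b l)⁻¹ *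
      (∑ j, b j * v j) * (starRingEnd ℂ) (b i) := fun b => congrFun (conjProj_apply b v) i
  rw [e4, e4, e1, e2, e3]
  field_simp

lemma conjProj_conjProj {N : ℕ} {a : Fin N → ℂ} (ha : a ≠ 0) (v : Fin N → ℂ) :
    conjProj a (conjProj a v) = conjProj a v := by
  have h := sum_conj_mul_self_ne_zero ha
  simp only [conjProj_apply a v, map_smul]
  rw [conjProj_apply]
  simp only [mul_comm (a _), inv_mul_cancel₀ h, one_smul]

lemma conjProj_ne_zero {N : ℕ} {a : Fin N → ℂ} (ha : a ≠ 0) : conjProj a ≠ 0 := by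
  intro h0
  have h := conjProj_apply a fun i => (starRingEnd ℂ) (a i)
  simp only [h0, mul_comm (a _), inv_mul_cancel₀ (sum_conj_mul_self_ne_zero ha), one_smul] at h
  apply ha
  ext i
  simpa using (congrFun h i).symm

lemma continuousAt_conjProj {N : ℕ} {K : Type*} [TopologicalSpace K] {a : K → Fin N → ℂ} {k₀ : K}
    (ha : ContinuousAt a k₀) (h0 : a k₀ ≠ 0) : ContinuousAt (fun k => conjProj (a k)) k₀ := by
  have h1 : ∀ i, ContinuousAt (fun k => a k i) k₀ := fun i =>
    (continuous_apply i).continuousAt.comp ha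
  have h2 : ∀ i, ContinuousAt (fun k => (starRingEnd ℂ) (a k i)) k₀ := fun i =>
    Complex.continuous_conj.continuousAt.comp (h1 i)
  refine ContinuousAt.fun_smul (ContinuousAt.inv₀ ?_ (sum_conj_mul_self_ne_zero h0)) ?_
  · exact tendsto_finsetSum _ fun i _ => (h2 i).mul (h1 i)
  · refine tendsto_finsetSum _ fun j _ => ?_
    have h3 : ContinuousAt (fun k => fun i => (starRingEnd ℂ) (a k i)) k₀ := continuousAt_pi.2 h2
    have h4 : ContinuousAt (fun k => a k j • fun i => (starRingEnd ℂ) (a k i)) k₀ := (h1 j).smul h3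
    exact (ContinuousLinearMap.smulRightL ℂ (Fin N → ℂ) (Fin N → ℂ)
      (ContinuousLinearMap.proj j)).continuous.continuousAt.comp h4

end Projections

/-! ### Triviality of line bundles along simplices and existence of skeleton frames. -/

section LineBundle

open Filter Topology

variable {X : Type*} [TopologicalSpace X] {F : Type*} {E : X → Type*}
  [NormedAddCommGroup F] [NormedSpace ℝ F]
  [∀ x, AddCommMonoid (E x)] [∀ x, Module ℝ (E x)] [TopologicalSpace (TotalSpace F E)]
  [∀ x, TopologicalSpace (E x)] [FiberBundle F E] [VectorBundle ℝ F E]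
  {J : ∀ x, E x →ₗ[ℝ] E x} {V : ∀ x, Submodule ℝ (E x)} {r : ℕ}

omit [NormedAddCommGroup F] [NormedSpace ℝ F] [∀ x, TopologicalSpace (E x)] [FiberBundle F E]
  [VectorBundle ℝ F E] in
lemma IsComplexSubbundle.exists_continuousOn (hV : IsComplexSubbundle F J V r) (x₀ : X) :
    ∃ U : Set X, IsOpen U ∧ x₀ ∈ U ∧ ∃ f : Fin r → ∀ x, E x,
      (∀ i, ContinuousOn (fun x => (⟨x, f i x⟩ : TotalSpace F E)) U) ∧
      ∀ x ∈ U, IsComplexBasis (J x) (V x) fun i => f i x := by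
  classical
  obtain ⟨U, hU, hx, f, hf⟩ := hV x₀
  refine ⟨U, hU, hx, fun i x => if h : x ∈ U then f i ⟨x, h⟩ else 0, fun i => ?_, fun x hxU => ?_⟩
  · rw [continuousOn_iff_continuous_domRestrict]
    convert hf.continuous i using 2 with u
    simp
  · simpa [hxU] using hf.basis ⟨x, hxU⟩

/-- A line bundle along a compact space is generated by finitely many continuous sections. -/
lemma IsComplexSubbundle.exists_generating_sections (hV : IsComplexSubbundle F J V 1)
    {K : Type*} [MetricSpace K] [CompactSpace K] (σ : C(K, X)) :
    ∃ (N : ℕ) (s : Fin N → ∀ k, E (σ k)),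
      (∀ i, Continuous fun k => (⟨σ k, s i k⟩ : TotalSpace F E)) ∧
      (∀ i k, s i k ∈ V (σ k)) ∧ ∀ k, ∃ i, s i k ≠ 0 := by
  classical
  have hloc : ∀ p : K, ∃ ε > 0, ∃ s : ∀ k, E (σ k),
      (Continuous fun k => (⟨σ k, s k⟩ : TotalSpace F E)) ∧ (∀ k, s k ∈ V (σ k)) ∧
      ∀ k ∈ Metric.ball p ε, s k ≠ 0 := by
    intro p
    obtain ⟨U, hU, hpU, f, hf, hbasis⟩ := hV.exists_continuousOn (σ p)
    obtain ⟨ε, hε, hball⟩ := Metric.isOpen_iff.1 (hU.preimage σ.continuous) p hpU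
    -- The cut-off vanishes from radius ε / 2 on, strictly inside the ball of radius ε over which
    -- the local frame is continuous.
    have hη : Continuous fun k => max 0 (ε / 2 - dist k p) := by fun_prop
    refine ⟨ε / 2, half_pos hε, fun k => max 0 (ε / 2 - dist k p) • f 0 (σ k), ?_, ?_, ?_⟩
    · rw [continuous_iff_continuousAt]
      intro k₀
      by_cases hk : dist k₀ p < ε
      · refine continuousAt_lift_smul σ.continuous hη.continuousAt ?_
        exact ((hf 0).continuousAt (hU.mem_nhds (hball hk))).comp (f := σ)
          σ.continuous.continuousAt
      · refine (continuous_lift_zero F σ.continuous).continuousAt.congr ?_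
        have : ∀ᶠ k in 𝓝 k₀, ε / 2 < dist k p :=
          (continuous_id.dist continuous_const).continuousAt.eventually
            (lt_mem_nhds (show ε / 2 < dist k₀ p by linarith))
        filter_upwards [this] with k hk
        rw [max_eq_left (by linarith), zero_smul]
    · intro k
      by_cases hk : dist k p < ε
      · exact Submodule.smul_mem _ _ ((hbasis _ (hball hk)).mem_apply 0)
      · change max 0 (ε / 2 - dist k p) • f 0 (σ k) ∈ _
        rw [max_eq_left (by linarith), zero_smul]
        exact Submodule.zero_mem _
    · intro k hk
      rw [Metric.mem_ball] at hk
      have hb := hbasis _ (hball (Metric.mem_ball.2 (by linarith) : k ∈ Metric.ball p ε))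
      intro h0
      have h1 : complexComb (J (σ k)) (fun i => f i (σ k))
          (fun _ => ((max 0 (ε / 2 - dist k p) : ℝ) : ℂ)) = complexComb (J (σ k))
          (fun i => f i (σ k)) (fun _ => 0) := by
        rw [complexComb_fin_one, complexComb_fin_one]
        simp only [Complex.ofReal_re, Complex.ofReal_im, zero_smul, add_zero, h0,
          Complex.zero_re, Complex.zero_im]
      have h2 := congrFun (hb.1 h1) 0
      simp only [Complex.ofReal_eq_zero] at h2
      rw [max_eq_right (by linarith)] at h2
      linarith
  choose ε hε s hs hsV hs0 using hloc
  obtain ⟨t, ht⟩ := isCompact_univ.elim_finite_subcover (fun p => Metric.ball p (ε p))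
    (fun p => Metric.isOpen_ball) fun p _ => mem_iUnion.2 ⟨p, Metric.mem_ball_self (hε p)⟩
  refine ⟨t.card, fun i => s (t.equivFin.symm i), fun i => hs _, fun i => hsV _, fun k => ?_⟩
  obtain ⟨p, hp⟩ := mem_iUnion.1 (ht (mem_univ k))
  obtain ⟨hpt, hpk⟩ := mem_iUnion.1 hp
  exact ⟨t.equivFin ⟨p, hpt⟩, by simpa using hs0 p k hpk⟩

variable [FiniteDimensional ℝ F]

/-- A complex line bundle along a compact contractible space is trivial. -/
theorem IsComplexSubbundle.exists_isFrameAlong (hJ : ∀ x v, J x (J x v) = (-1 : ℝ) • v)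
    (hJc : Continuous fun p : TotalSpace F E => (⟨p.1, J p.1 p.2⟩ : TotalSpace F E))
    (hV : IsComplexSubbundle F J V 1) {K : Type*} [MetricSpace K] [CompactSpace K]
    [ContractibleSpace K] (σ : C(K, X)) :
    ∃ g : Fin 1 → ∀ k, E (σ k), IsFrameAlong F J V σ g := by
  obtain ⟨N, s, hs, hsV, hs0⟩ := hV.exists_generating_sections σ
  choose U hU hxU f hf hbasis using hV.exists_continuousOn
  -- The basis at x comes from the local frame chosen around x and need not vary continuously.
  -- Another choice rescales `a k` by a nonzero factor, which `conjProj` ignores.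
  let b : ∀ x, Fin 1 → E x := fun x i => f x i x
  have hb : ∀ x, IsComplexBasis (J x) (V x) (b x) := fun x => hbasis x x (hxU x)
  let a : K → Fin N → ℂ := fun k j => coords (J (σ k)) (b (σ k)) (s j k) 0
  have ha_spec : ∀ k j, complexComb (J (σ k)) (b (σ k)) (fun _ => a k j) = s j k := by
    intro k j
    rw [← (hb (σ k)).coords_spec (hsV j k)]
    congr 1
    ext i
    rw [Subsingleton.elim i 0]
  have ha0 : ∀ k, a k ≠ 0 := by
    intro k h0
    obtain ⟨j, hj⟩ := hs0 k
    apply hj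
    rw [← ha_spec, h0, complexComb_fin_one]
    simp
  have hQ : Continuous fun k => conjProj (a k) := by
    rw [continuous_iff_continuousAt]
    intro k₀
    let g : Fin 1 → ∀ k, E (σ k) := fun i k => f (σ k₀) i (σ k)
    have hg : ∀ i, ContinuousAt (fun k => (⟨σ k, g i k⟩ : TotalSpace F E)) k₀ := fun i =>
      ((hf (σ k₀) i).continuousAt ((hU _).mem_nhds (hxU _))).comp (f := σ)
        σ.continuous.continuousAt
    have hnear : ∀ᶠ k in 𝓝 k₀, σ k ∈ U (σ k₀) :=
      σ.continuous.continuousAt ((hU _).mem_nhds (hxU _))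
    -- Near k₀ the single frame around σ k₀ gives coordinates continuous at k₀ and proportional to
    -- `a`.
    let a' : K → Fin N → ℂ := fun k j => coords (J (σ k)) (fun i => g i k) (s j k) 0
    have ha' : ContinuousAt a' k₀ := by
      refine continuousAt_pi.2 fun j => ?_
      have : ContinuousAt (fun k => coords (J (σ k)) (fun i => g i k) (s j k)) k₀ := by
        refine continuousAt_coords (V := V) hJc σ.continuous hg (hbasis _ _ (hxU _)) ?_
        refine (hs j).continuousAt.congr ?_
        filter_upwards [hnear] with k hk
        rw [(hbasis _ _ hk).coords_spec (hsV j k)]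
      exact (continuous_apply 0).continuousAt.comp this
    have hrel : ∀ k, σ k ∈ U (σ k₀) → ∃ μ : ℂ, μ ≠ 0 ∧ a k = μ • a' k := by
      intro k hk
      have hgk := hbasis _ _ hk
      refine ⟨changeDet (J (σ k)) (b (σ k)) (fun i => g i k),
        (hb _).changeDet_ne_zero (hJ _) hgk, ?_⟩
      ext j
      have := (hb (σ k)).changeDet_mul (hJ _) hgk (f := fun _ => s j k) fun _ => hsV j k
      simp only [changeDet, Matrix.det_fin_one] at this ⊢
      exact this
    have ha'0 : a' k₀ ≠ 0 := by
      intro h0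
      obtain ⟨μ, -, h⟩ := hrel k₀ (hxU _)
      exact ha0 k₀ (by rw [h, h0, smul_zero])
    refine (continuousAt_conjProj ha' ha'0).congr ?_
    filter_upwards [hnear] with k hk
    obtain ⟨μ, hμ, h⟩ := hrel k hk
    rw [h, conjProj_smul _ hμ]
  obtain ⟨v, hv, hv'⟩ := exists_continuous_fixed_vector hQ
    (fun k => conjProj_conjProj (ha0 k)) fun k => conjProj_ne_zero (ha0 k)
  -- This sum is the coefficient, in the basis b, of the section ∑ v_j s_j; were it zero, the
  -- projection would kill its fixed vector v k.
  have hsum : ∀ k, ∑ j, a k j * v k j ≠ 0 := by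
    intro k h0
    apply (hv' k).1
    rw [← (hv' k).2, conjProj_apply, h0, mul_zero, zero_smul]
  have hcomb : ∀ k, complexComb (J (σ k)) (fun j => s j k) (v k) =
      complexComb (J (σ k)) (b (σ k)) (fun _ => ∑ j, a k j * v k j) := by
    intro k
    have : (fun j => s j k) = fun j => complexComb (J (σ k)) (b (σ k)) (fun _ => a k j) :=
      funext fun j => (ha_spec k j).symm
    rw [this, complexComb_complexComb (hJ _) (b (σ k)) (fun _ j => a k j)]
    rfl
  refine ⟨fun _ k => complexComb (J (σ k)) (fun j => s j k) (v k), fun _ => ?_, fun k => ?_⟩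
  · rw [continuous_iff_continuousAt]
    exact fun k₀ => continuousAt_lift_complexComb hJc σ.continuous
      (fun i => (hs i).continuousAt) fun i => ((continuous_apply i).comp hv).continuousAt
  · refine (hb (σ k)).of_mem_of_ne_zero (hJ _) ?_ ?_
    · rw [hcomb]
      exact (hb (σ k)).mem _
    · rw [hcomb]
      intro h0
      apply hsum k
      refine congrFun ((hb (σ k)).1 (h0.trans ?_) :
        (fun _ : Fin 1 => ∑ j, a k j * v k j) = fun _ => 0) 0
      rw [complexComb_fin_one]
      simp

theorem IsComplexSubbundle.hasSimplexFrames (hJ : ∀ x v, J x (J x v) = (-1 : ℝ) • v)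
    (hJc : Continuous fun p : TotalSpace F E => (⟨p.1, J p.1 p.2⟩ : TotalSpace F E))
    (hV : IsComplexSubbundle F J V 1) : HasSimplexFrames F J V 1 :=
  ⟨hJ, hJc, fun _ σ => hV.exists_isFrameAlong hJ hJc σ⟩

-- A frame along the edge is rescaled by the exponential of the barycentric interpolation between
-- logarithms of the required end coefficients.
omit [FiniteDimensional ℝ F] in
lemma HasSimplexFrames.exists_frame_with_ends (hV : HasSimplexFrames F J V 1)
    (e : C(Simplex 1, X)) (β : ∀ x, Fin 1 → E x) (hβ : ∀ x, IsComplexBasis (J x) (V x) (β x)) :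
    ∃ h : Fin 1 → ∀ t, E (e t), IsFrameAlong F J V e h ∧
      ∀ m i, h i (stdSimplex.vertex m) = β (e (stdSimplex.vertex m)) i := by
  obtain ⟨g, hg⟩ := hV.exists_frame 1 e
  let α : Fin 2 → ℂ := fun m => changeDet (J (e (stdSimplex.vertex m)))
    (fun i => g i (stdSimplex.vertex m)) (β (e (stdSimplex.vertex m)))
  have hα : ∀ m, α m ≠ 0 := fun m => (hg.basis _).changeDet_ne_zero (hV.sq _) (hβ _)
  let u : Simplex 1 → ℂ := fun t =>
    Complex.exp (((t 0 : ℝ) : ℂ) * Complex.log (α 0) + ((t 1 : ℝ) : ℂ) * Complex.log (α 1))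
  have hcoord : ∀ i : Fin 2, Continuous fun t : Simplex 1 => (t i : ℝ) := fun i =>
    (continuous_apply i).comp continuous_subtype_val
  have hu : Continuous u := by
    have h0 := hcoord 0
    have h1 := hcoord 1
    exact (((Complex.continuous_ofReal.comp h0).mul continuous_const).add
      ((Complex.continuous_ofReal.comp h1).mul continuous_const)).cexp
  have hvert : ∀ m, u (stdSimplex.vertex m) = α m := by
    intro m
    fin_cases m
    · simp [u, Complex.exp_log (hα 0)]
    · simp [u, Complex.exp_log (hα 1)]
  refine ⟨fun _ t => complexComb (J (e t)) (fun i => g i t) fun _ => u t,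
    ⟨fun _ => ?_, fun t => ?_⟩, fun m i => ?_⟩
  · rw [continuous_iff_continuousAt]
    exact fun t => continuousAt_lift_complexComb hV.continuous_J e.continuous
      (fun i => (hg.continuous i).continuousAt) fun _ => hu.continuousAt
  · refine (hg.basis t).of_mem_of_ne_zero (hV.sq _) ((hg.basis t).mem _) fun h0 => ?_
    refine Complex.exp_ne_zero _ (congrFun ((hg.basis t).1 (h0.trans ?_) :
      (fun _ : Fin 1 => u t) = fun _ => 0) 0)
    rw [complexComb_fin_one]
    simp
  · simp only [hvert]
    rw [(hg.basis (stdSimplex.vertex m)).changeMatrix_spec (fun j => (hβ _).mem_apply j) i]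
    congr 1
    ext l
    simp only [α, changeDet, Matrix.det_fin_one]
    rw [Subsingleton.elim l 0, Subsingleton.elim i 0]

-- Inside A the choices are forced to be s; elsewhere they are free. The constraints are compatible
-- because the vertex bases over A already come from s.
omit [FiniteDimensional ℝ F] in
lemma HasSimplexFrames.nonempty_skeletonFrame (hV : HasSimplexFrames F J V 1) {A : Set X}
    {s : Fin 1 → ∀ x : A, E x} (hs : IsFrameAlong F J V (fun x : A => (x : X)) s) :
    Nonempty (SkeletonFrame F J V A s) := by
  classical
  have hvert : ∀ x, ∃ β : Fin 1 → E x, IsComplexBasis (J x) (V x) β ∧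
      ∀ (hx : x ∈ A) i, β i = s i ⟨x, hx⟩ := by
    intro x
    by_cases hx : x ∈ A
    · exact ⟨fun i => s i ⟨x, hx⟩, hs.basis ⟨x, hx⟩, fun _ _ => rfl⟩
    · obtain ⟨g, hg⟩ := hV.exists_frame 0 (.const _ x)
      exact ⟨fun i => g i (stdSimplex.vertex 0), hg.basis (stdSimplex.vertex 0),
        fun h => absurd h hx⟩
  choose β hβ hβA using hvert
  have hedge : ∀ e : C(Simplex 1, X), ∃ h : Fin 1 → ∀ t, E (e t), IsFrameAlong F J V e h ∧
      (∀ m i, h i (stdSimplex.vertex m) = β (e (stdSimplex.vertex m)) i) ∧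
      ∀ (he : range e ⊆ A) i t, h i t = s i ⟨e t, he (mem_range_self t)⟩ := by
    intro e
    by_cases he : range e ⊆ A
    · refine ⟨fun i t => s i ⟨e t, he (mem_range_self t)⟩,
        hs.comp (ρ := fun t => (⟨e t, he (mem_range_self t)⟩ : A)) (by fun_prop),
        fun m i => (hβA _ _ i).symm, fun _ _ _ => rfl⟩
    · obtain ⟨h, h1, h2⟩ := hV.exists_frame_with_ends e β hβ
      exact ⟨h, h1, h2, fun h => absurd h he⟩
  choose ed hed hend hedA using hedge
  exact ⟨⟨β, hβ, fun x hx i => hβA x hx i, ed, hed, hend, hedA⟩⟩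

end LineBundle


/-! ### Direct sums of line bundles -/

section DirectSum

section Algebra

variable {M₁ M₂ : Type*} [AddCommMonoid M₁] [Module ℝ M₁] [AddCommMonoid M₂] [Module ℝ M₂]
  {J₁ : M₁ →ₗ[ℝ] M₁} {J₂ : M₂ →ₗ[ℝ] M₂} {V : Submodule ℝ M₂} {ι : M₁ →ₗ[ℝ] M₂}

lemma complexComb_pair (hJ : ∀ v, ι (J₁ v) = J₂ (ι v)) (f : Fin 1 → M₁) (g : Fin 1 → M₂)
    (c : Fin 2 → ℂ) : complexComb J₂ ![ι (f 0), g 0] c =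
      ι (complexComb J₁ f fun _ => c 0) + complexComb J₂ g fun _ => c 1 := by
  simp [complexComb, hJ]

lemma IsComplexBasis.pair (hJ : ∀ v, ι (J₁ v) = J₂ (ι v)) (hι : Function.Injective ι)
    (hV : IsCompl (LinearMap.range ι) V) {f : Fin 1 → M₁} {g : Fin 1 → M₂}
    (hf : IsComplexBasis J₁ ⊤ f) (hg : IsComplexBasis J₂ V g) :
    IsComplexBasis J₂ ⊤ ![ι (f 0), g 0] := by
  have hconst : ∀ c : Fin 1 → ℂ, (fun _ => c 0) = c := fun c => by
    ext i; rw [Subsingleton.elim i 0]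
  constructor
  · intro c d h
    rw [complexComb_pair hJ, complexComb_pair hJ] at h
    set a := complexComb J₁ f fun _ => c 0 with ha
    set a' := complexComb J₁ f fun _ => d 0 with ha'
    set w := complexComb J₂ g fun _ => c 1 with hw
    set w' := complexComb J₂ g fun _ => d 1 with hw'
    let _ := Module.addCommMonoidToAddCommGroup ℝ (M := M₁)
    let _ := Module.addCommMonoidToAddCommGroup ℝ (M := M₂)
    have h1 : ι (a + (-1 : ℝ) • a') = w' + (-1 : ℝ) • w := by
      rw [map_add, map_smul]
      calc ι a + (-1 : ℝ) • ι a' = (ι a + w) + ((-1 : ℝ) • w + (-1 : ℝ) • ι a') := by module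
        _ = w' + (-1 : ℝ) • w := by rw [h]; module
    have h2 : ι (a + (-1 : ℝ) • a') = 0 := by
      refine Submodule.disjoint_def.1 hV.disjoint _ (LinearMap.mem_range_self ι _) ?_
      rw [h1]
      exact V.add_mem (hg.mem _) (V.smul_mem _ (hg.mem _))
    have h3 : a = a' := by
      have : a + (-1 : ℝ) • a' = 0 := hι (by rw [h2, map_zero])
      rw [show a = (a + (-1 : ℝ) • a') + a' by module, this, zero_add]
    have h4 : w = w' := by
      rw [h2] at h1
      rw [show w' = (w' + (-1 : ℝ) • w) + w by module, ← h1, zero_add]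
    have h5 := congrFun (hf.1 h3) 0
    have h6 := congrFun (hg.1 h4) 0
    ext i
    fin_cases i
    · exact h5
    · exact h6
  · refine Subset.antisymm (fun _ _ => Submodule.mem_top) fun m _ => ?_
    have hm : m ∈ LinearMap.range ι ⊔ V := by rw [hV.sup_eq_top]; exact Submodule.mem_top
    obtain ⟨_, ⟨a, rfl⟩, w, hw, rfl⟩ := Submodule.mem_sup.1 hm
    refine ⟨![coords J₁ f a 0, coords J₂ g w 0], ?_⟩
    rw [complexComb_pair hJ]
    simp only [Matrix.cons_val_zero, Matrix.cons_val_one, hconst]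
    rw [hf.coords_spec Submodule.mem_top, hg.coords_spec hw]

/-- In split bases the transition matrix is diagonal. -/
lemma changeDet_pair (hJ : ∀ v, ι (J₁ v) = J₂ (ι v)) (hι : Function.Injective ι)
    (hV : IsCompl (LinearMap.range ι) V) {f f' : Fin 1 → M₁} {g g' : Fin 1 → M₂}
    (hf : IsComplexBasis J₁ ⊤ f) (hg : IsComplexBasis J₂ V g) (hg' : g' 0 ∈ V) :
    changeDet J₂ ![ι (f 0), g 0] ![ι (f' 0), g' 0] = changeDet J₁ f f' * changeDet J₂ g g' := by
  have hconst : ∀ c : Fin 1 → ℂ, (fun _ => c 0) = c := fun c => by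
    ext i; rw [Subsingleton.elim i 0]
  rw [(IsComplexBasis.pair hJ hι hV hf hg).changeDet_eq
    (A := !![changeMatrix J₁ f f' 0 0, 0; 0, changeMatrix J₂ g g' 0 0])]
  · simp [changeDet, Matrix.det_fin_two_of]
  · intro k
    have h0 : complexComb J₂ g (fun _ => 0) = 0 := by simp [complexComb_fin_one]
    have h0' : complexComb J₁ f (fun _ => 0) = 0 := by simp [complexComb_fin_one]
    rw [complexComb_pair hJ]
    fin_cases k
    · simp [changeMatrix, h0, hconst, hf.coords_spec (V := ⊤) Submodule.mem_top]
    · simp [changeMatrix, h0', hconst, hg.coords_spec hg']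

end Algebra

variable {X : Type*} [TopologicalSpace X] {F₁ F₂ : Type*} {E₁ E₂ : X → Type*}
  [∀ x, AddCommMonoid (E₁ x)] [∀ x, Module ℝ (E₁ x)] [TopologicalSpace (TotalSpace F₁ E₁)]
  [∀ x, AddCommMonoid (E₂ x)] [∀ x, Module ℝ (E₂ x)] [TopologicalSpace (TotalSpace F₂ E₂)]
  {J₁ : ∀ x, E₁ x →ₗ[ℝ] E₁ x} {J₂ : ∀ x, E₂ x →ₗ[ℝ] E₂ x} {V : ∀ x, Submodule ℝ (E₂ x)}
  {ι : ∀ x, E₁ x →ₗ[ℝ] E₂ x} {A : Set X}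

variable (F₁ F₂ J₁ J₂ V ι) in
/-- The complex bundle `E₂` is the direct sum of the image of `E₁` under `ι` and of `V`. -/
structure IsBundleSum : Prop where
  map_J : ∀ x v, ι x (J₁ x v) = J₂ x (ι x v)
  injective : ∀ x, Function.Injective (ι x)
  isCompl : ∀ x, IsCompl (LinearMap.range (ι x)) (V x)
  continuous : Continuous fun p : TotalSpace F₁ E₁ => (⟨p.1, ι p.1 p.2⟩ : TotalSpace F₂ E₂)

variable (ι) in
/-- The frame `(ι f, g)`. -/
def pairFrame {K : Type*} (σ : K → X) (f : Fin 1 → ∀ k, E₁ (σ k)) (g : Fin 1 → ∀ k, E₂ (σ k)) :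
    Fin 2 → ∀ k, E₂ (σ k) :=
  ![fun k => ι (σ k) (f 0 k), g 0]

omit [TopologicalSpace X] [TopologicalSpace (TotalSpace F₁ E₁)]
  [TopologicalSpace (TotalSpace F₂ E₂)] in
lemma pairFrame_apply {K : Type*} (σ : K → X) (f : Fin 1 → ∀ k, E₁ (σ k))
    (g : Fin 1 → ∀ k, E₂ (σ k)) (k : K) :
    (fun i => pairFrame ι σ f g i k) = ![ι (σ k) (f 0 k), g 0 k] := by
  ext i
  fin_cases i <;> rfl

omit [TopologicalSpace X] in
lemma IsBundleSum.isFrameAlong (hι : IsBundleSum F₁ F₂ J₁ J₂ V ι) {K : Type*} [TopologicalSpace K]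
    {σ : K → X} {f : Fin 1 → ∀ k, E₁ (σ k)} {g : Fin 1 → ∀ k, E₂ (σ k)}
    (hf : IsFrameAlong F₁ J₁ (fun _ => ⊤) σ f) (hg : IsFrameAlong F₂ J₂ V σ g) :
    IsFrameAlong F₂ J₂ (fun _ => ⊤) σ (pairFrame ι σ f g) := by
  refine ⟨Fin.forall_fin_two.2 ⟨hι.continuous.comp (hf.continuous 0), hg.continuous 0⟩,
    fun k => ?_⟩
  rw [pairFrame_apply]
  exact (hf.basis k).pair (hι.map_J _) (hι.injective _) (hι.isCompl _) (hg.basis k)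

/-- The rank two bundle is not covered by the line bundle argument; its frames are assembled from
those of the summands. -/
lemma IsBundleSum.hasSimplexFrames (hι : IsBundleSum F₁ F₂ J₁ J₂ V ι)
    (h₁ : HasSimplexFrames F₁ J₁ (fun _ => ⊤) 1) (h₂ : HasSimplexFrames F₂ J₂ V 1) :
    HasSimplexFrames F₂ J₂ (fun _ => ⊤) 2 := by
  refine ⟨h₂.sq, h₂.continuous_J, fun n σ => ?_⟩
  obtain ⟨f, hf⟩ := h₁.exists_frame n σ
  obtain ⟨g, hg⟩ := h₂.exists_frame n σ
  exact ⟨_, hι.isFrameAlong hf hg⟩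

variable {s₁ : Fin 1 → ∀ x : A, E₁ x} {s₂ : Fin 1 → ∀ x : A, E₂ x}

/-- The direct sum of frames on the singular 1-skeleton. -/
def SkeletonFrame.pair (hι : IsBundleSum F₁ F₂ J₁ J₂ V ι)
    (Φ₁ : SkeletonFrame F₁ J₁ (fun _ => ⊤) A s₁) (Φ₂ : SkeletonFrame F₂ J₂ V A s₂) :
    SkeletonFrame F₂ J₂ (fun _ => ⊤) A (pairFrame ι (fun x : A => (x : X)) s₁ s₂) where
  vertex x := ![ι x (Φ₁.vertex x 0), Φ₂.vertex x 0]
  vertex_basis x := (Φ₁.vertex_basis x).pair (hι.map_J _) (hι.injective _) (hι.isCompl _)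
    (Φ₂.vertex_basis x)
  vertex_eq x hx := Fin.forall_fin_two.2
    ⟨congrArg (ι x) (Φ₁.vertex_eq x hx 0), Φ₂.vertex_eq x hx 0⟩
  edge σ := pairFrame ι σ (Φ₁.edge σ) (Φ₂.edge σ)
  edge_frame σ := hι.isFrameAlong (Φ₁.edge_frame σ) (Φ₂.edge_frame σ)
  edge_end σ m := Fin.forall_fin_two.2
    ⟨congrArg (ι _) (Φ₁.edge_end σ m 0), Φ₂.edge_end σ m 0⟩
  edge_eq σ hσ := Fin.forall_fin_two.2
    ⟨fun t => congrArg (ι _) (Φ₁.edge_eq σ hσ 0 t), fun t => Φ₂.edge_eq σ hσ 0 t⟩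

lemma SkeletonFrame.edgeDet_pair (hι : IsBundleSum F₁ F₂ J₁ J₂ V ι)
    {Φ₁ : SkeletonFrame F₁ J₁ (fun _ => ⊤) A s₁} {Φ₂ : SkeletonFrame F₂ J₂ V A s₂}
    {K : Type*} [TopologicalSpace K] {T : C(K, X)} {f : Fin 1 → ∀ k, E₁ (T k)}
    {g : Fin 1 → ∀ k, E₂ (T k)} (hf : IsFrameAlong F₁ J₁ (fun _ => ⊤) T f)
    (hg : IsFrameAlong F₂ J₂ V T g) (ρ : C(Simplex 1, K)) (t : Simplex 1) :
    (Φ₁.pair hι Φ₂).edgeDet T (pairFrame ι T f g) ρ t = Φ₁.edgeDet T f ρ t * Φ₂.edgeDet T g ρ t := by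
  have h1 : (fun i => pairFrame ι T f g i (ρ t)) = ![ι (T (ρ t)) (f 0 (ρ t)), g 0 (ρ t)] :=
    pairFrame_apply _ _ _ _
  have h2 : (fun i => (Φ₁.pair hι Φ₂).edge (T.comp ρ) i t) =
      ![ι (T (ρ t)) (Φ₁.edge (T.comp ρ) 0 t), Φ₂.edge (T.comp ρ) 0 t] :=
    pairFrame_apply (T.comp ρ) (Φ₁.edge (T.comp ρ)) (Φ₂.edge (T.comp ρ)) t
  have h3 : Φ₂.edge (T.comp ρ) 0 t ∈ V (T (ρ t)) :=
    ((Φ₂.edge_frame (T.comp ρ)).basis t).mem_apply 0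
  unfold edgeDet
  rw [h1, h2]
  exact changeDet_pair (f := fun i => f i (ρ t)) (g := fun i => g i (ρ t))
    (f' := fun i => Φ₁.edge (T.comp ρ) i t) (g' := fun i => Φ₂.edge (T.comp ρ) i t)
    (hι.map_J _) (hι.injective _) (hι.isCompl _) (hf.basis _) (hg.basis _) h3

/-- In a split reference frame the boundary determinants are products, so their logarithm variations
add. -/
lemma IsObstruction.pair (hι : IsBundleSum F₁ F₂ J₁ J₂ V ι)
    {Φ₁ : SkeletonFrame F₁ J₁ (fun _ => ⊤) A s₁} {Φ₂ : SkeletonFrame F₂ J₂ V A s₂}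
    {σ : C(Simplex 2, X)} {n₁ n₂ : ℤ} (h₁ : IsObstruction Φ₁ σ n₁) (h₂ : IsObstruction Φ₂ σ n₂) :
    IsObstruction (Φ₁.pair hι Φ₂) σ (n₁ + n₂) := by
  obtain ⟨f, hf, z, hz, hn⟩ := (isObstruction_iff _ _ _).1 h₁
  obtain ⟨g, hg, w, hw, hm⟩ := (isObstruction_iff _ _ _).1 h₂
  refine (isObstruction_iff _ _ _).2 ⟨_, hι.isFrameAlong hf hg, fun k => z k + w k,
    fun k => ?_, ?_⟩
  · convert (hz k).mul (hw k) using 1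
    ext t
    exact SkeletonFrame.edgeDet_pair hι hf hg (face k) t
  · push_cast
    linear_combination hn + hm

/-- The relative first Chern class is additive. -/
theorem IsRelChernClass.pair (hι : IsBundleSum F₁ F₂ J₁ J₂ V ι) {z₁ z₂ : RelCohomology A 2}
    (h₁ : IsRelChernClass F₁ J₁ (fun _ => ⊤) A s₁ z₁) (h₂ : IsRelChernClass F₂ J₂ V A s₂ z₂) :
    IsRelChernClass F₂ J₂ (fun _ => ⊤) A (pairFrame ι (fun x : A => (x : X)) s₁ s₂)
      (z₁ + z₂) := by
  obtain ⟨Φ₁, c₁, hc₁, rfl⟩ := h₁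
  obtain ⟨Φ₂, c₂, hc₂, rfl⟩ := h₂
  exact ⟨Φ₁.pair hι Φ₂, c₁ + c₂, fun σ => (hc₁ σ).pair hι (hc₂ σ), rfl⟩

lemma relChernClass_eq {r : ℕ} {s : Fin r → ∀ x : A, E₂ x} {z : RelCohomology A 2}
    (h : ∃! z, IsRelChernClass F₂ J₂ V A s z) (hz : IsRelChernClass F₂ J₂ V A s z) :
    relChernClass F₂ J₂ V A s = z := by
  have h' : ∃ z, IsRelChernClass F₂ J₂ V A s z := ⟨z, hz⟩
  rw [relChernClass, dif_pos h']
  exact h.unique h'.choose_spec hz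

end DirectSum


/-! ### Holomorphic curves -/

section Curves

/-- In real dimension two, every nonzero vector is a complex basis. -/
lemma isComplexBasis_of_finrank_eq_two {M : Type*} [AddCommGroup M] [Module ℝ M]
    [FiniteDimensional ℝ M] (hM : Module.finrank ℝ M = 2) {J : M →ₗ[ℝ] M}
    (hJ : ∀ v, J (J v) = (-1 : ℝ) • v) {f : Fin 1 → M} (h0 : f 0 ≠ 0) :
    IsComplexBasis J ⊤ f := by
  have hinj : Function.Injective (complexCombL J f) := by
    rw [injective_iff_map_eq_zero]
    intro c hc
    rw [complexCombL_apply, complexComb_fin_one] at hc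
    have h1 : (c 0).re • J (f 0) + (c 0).im • J (J (f 0)) = 0 := by
      rw [← map_smul, ← map_smul, ← map_add, hc, map_zero]
    rw [hJ] at h1
    have h2 : ((c 0).re ^ 2 + (c 0).im ^ 2) • f 0 = 0 := by
      calc ((c 0).re ^ 2 + (c 0).im ^ 2) • f 0 =
          (c 0).re • ((c 0).re • f 0 + (c 0).im • J (f 0)) -
            (c 0).im • ((c 0).re • J (f 0) + (c 0).im • (-1 : ℝ) • f 0) := by module
        _ = 0 := by rw [hc, h1, smul_zero, smul_zero, sub_zero]
    have h3 := (smul_eq_zero.1 h2).resolve_right h0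
    ext i
    rw [Subsingleton.elim i 0]
    refine Complex.ext ?_ ?_
    · simp only [Pi.zero_apply, Complex.zero_re]
      nlinarith
    · simp only [Pi.zero_apply, Complex.zero_im]
      nlinarith
  have hsurj : Function.Surjective (complexCombL J f) :=
    (LinearMap.injective_iff_surjective_of_finrank_eq_finrank
      (by simp [hM, Module.finrank_pi_fintype, Complex.finrank_real_complex])).1 hinj
  exact ⟨hinj, hsurj.range_eq⟩

variable {S : Type*} [TopologicalSpace S] [ChartedSpace (EuclideanHalfSpace 2) S]
  [IsManifold (𝓡∂ 2) ∞ S]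

lemma AlmostComplexStructure.J_J {n : ℕ} [NeZero n] {M : Type*} [TopologicalSpace M]
    [ChartedSpace (EuclideanHalfSpace n) M] [IsManifold (𝓡∂ n) ∞ M]
    (J : AlmostComplexStructure n M) (x : M) (v : TangentSpace (𝓡∂ n) x) :
    J.J x (J.J x v) = (-1 : ℝ) • v := by
  rw [J.sq, neg_one_smul]

instance (n : ℕ) [NeZero n] {M : Type*} [TopologicalSpace M]
    [ChartedSpace (EuclideanHalfSpace n) M] (x : M) :
    FiniteDimensional ℝ (TangentSpace (𝓡∂ n) x) :=
  inferInstanceAs (FiniteDimensional ℝ (EuclideanSpace ℝ (Fin n)))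

lemma AlmostComplexStructure.isComplexBasis (j : AlmostComplexStructure 2 S) {x : S}
    {f : Fin 1 → TangentSpace (𝓡∂ 2) x} (h0 : f 0 ≠ 0) : IsComplexBasis (j.J x) ⊤ f :=
  isComplexBasis_of_finrank_eq_two
    (finrank_euclideanSpace_fin : Module.finrank ℝ (EuclideanSpace ℝ (Fin 2)) = 2) (j.J_J x) h0

/-- A constant nonzero vector in a trivialization of TS is nowhere zero, which on a surface already
makes it a complex frame. -/
lemma AlmostComplexStructure.isComplexSubbundle (j : AlmostComplexStructure 2 S) :
    IsComplexSubbundle (EuclideanSpace ℝ (Fin 2)) j.J (fun _ => ⊤) 1 := by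
  intro x₀
  let e := trivializationAt (EuclideanSpace ℝ (Fin 2)) (TangentSpace (𝓡∂ 2) : S → Type _) x₀
  let v : EuclideanSpace ℝ (Fin 2) := EuclideanSpace.single 0 1
  have hv : v ≠ 0 := by simp [v]
  refine ⟨e.baseSet, e.open_baseSet, mem_baseSet_trivializationAt _ _ _,
    fun _ u => e.symm u v, fun _ => ?_, fun u => j.isComplexBasis ?_⟩
  · exact e.continuousOn_symm.comp_continuous
      (f := fun u : e.baseSet => ((u : S), v)) (by fun_prop) fun u => ⟨u.2, mem_univ _⟩
  · intro h0
    apply hv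
    have h1 : e.linearMapAt ℝ u (e.symm u v) = v := e.linearMapAt_symm u.2 v
    rw [← h1, h0, map_zero]

variable {W : Type*} [TopologicalSpace W] [ChartedSpace (EuclideanHalfSpace 4) W]
  [IsManifold (𝓡∂ 4) ∞ W]

omit [ChartedSpace (EuclideanHalfSpace 2) S] [IsManifold (𝓡∂ 2) ∞ S] in
lemma continuous_pullbackJ (J : AlmostComplexStructure 4 W) (φ : S → W) :
    Continuous fun p : TotalSpace (EuclideanSpace ℝ (Fin 4))
      (φ *ᵖ (TangentSpace (𝓡∂ 4) : W → Type _)) =>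
      (⟨p.1, pullbackJ J φ p.1 p.2⟩ : TotalSpace (EuclideanSpace ℝ (Fin 4))
        (φ *ᵖ (TangentSpace (𝓡∂ 4) : W → Type _))) := by
  rw [(inducing_pullbackTotalSpaceEmbedding _ _ φ).continuous_iff]
  exact (Pullback.continuous_proj _ _ φ).prodMk
    (J.smooth.continuous.comp (Pullback.continuous_lift _ _ φ))

lemma isBundleSum_mfderiv {j : AlmostComplexStructure 2 S} {J : AlmostComplexStructure 4 W}
    {φ : S → W} (hφ : IsProperEmbedding φ) (hhol : IsJHolomorphic j J φ)
    {ν : ∀ x, Submodule ℝ ((φ *ᵖ (TangentSpace (𝓡∂ 4) : W → Type _)) x)}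
    (hν : IsNormalBundle J φ ν) :
    IsBundleSum (E₂ := φ *ᵖ (TangentSpace (𝓡∂ 4) : W → Type _)) (EuclideanSpace ℝ (Fin 2))
      (EuclideanSpace ℝ (Fin 4)) j.J (pullbackJ J φ) ν
      (fun x => (mfderiv (𝓡∂ 2) (𝓡∂ 4) φ x).toLinearMap) where
  map_J := hhol
  injective := hφ.injective
  isCompl := hν.isCompl
  continuous := by
    -- The total space of the pullback has the topology induced from S × TW; the component in TW is
    -- the tangent map of φ.
    rw [(inducing_pullbackTotalSpaceEmbedding _ _ φ).continuous_iff]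
    exact (FiberBundle.continuous_proj _ _).prodMk
      (hφ.smooth.continuous_tangentMap (by simp))

end Curves

end RelChern

end

/-! ### The relative adjunction formula. -/

theorem proposition2p1
    {W : Type*} [TopologicalSpace W] [T2Space W] [SecondCountableTopology W]
    [ChartedSpace (EuclideanHalfSpace 4) W] [IsManifold (𝓡∂ 4) ∞ W]
    (J : AlmostComplexStructure 4 W)
    {S : Type*} [TopologicalSpace S]
    [ChartedSpace (EuclideanHalfSpace 2) S] [IsManifold (𝓡∂ 2) ∞ S]
    (j : AlmostComplexStructure 2 S)
    (φ : S → W) (hφ : IsProperEmbedding φ) (hhol : IsJHolomorphic j J φ)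
    (htrans : IsBoundaryTransverse J φ)
    (ν : ∀ x, Submodule ℝ ((φ *ᵖ (TangentSpace (𝓡∂ 4) : W → Type _)) x))
    (hν : IsNormalBundle J φ ν)
    (τ : ∀ x : (𝓡∂ 2).boundary S, TangentSpace (𝓡∂ 2) (x : S))
    (hτ_cont : Continuous fun x : (𝓡∂ 2).boundary S => (⟨(x : S), τ x⟩ : TangentBundle (𝓡∂ 2) S))
    (hτ_pos : ∀ x : (𝓡∂ 2).boundary S, IsPositiveBoundaryTangent j (x : S) (τ x))
    (s : ∀ x : (𝓡∂ 2).boundary S, (φ *ᵖ (TangentSpace (𝓡∂ 4) : W → Type _)) (x : S))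
    (hs_cont : Continuous fun x : (𝓡∂ 2).boundary S =>
      (⟨(x : S), s x⟩ :
        TotalSpace (EuclideanSpace ℝ (Fin 4)) (φ *ᵖ (TangentSpace (𝓡∂ 4) : W → Type _))))
    (hs_mem : ∀ x : (𝓡∂ 2).boundary S, s x ∈ ν (x : S)) (hs_ne : ∀ x, s x ≠ 0) :
    -- the three relative Chern classes are well defined
    (∃! z, IsRelChernClass (EuclideanSpace ℝ (Fin 4)) (pullbackJ J φ) (fun _ => ⊤)
      ((𝓡∂ 2).boundary S) ![pushforwardSection φ τ, s] z) ∧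
    (∃! z, IsRelChernClass (EuclideanSpace ℝ (Fin 2)) j.J (fun _ => ⊤)
      ((𝓡∂ 2).boundary S) ![τ] z) ∧
    (∃! z, IsRelChernClass (EuclideanSpace ℝ (Fin 4)) (pullbackJ J φ) ν
      ((𝓡∂ 2).boundary S) ![s] z) ∧
    -- the adjunction formula
    relChernClass (EuclideanSpace ℝ (Fin 4)) (pullbackJ J φ) (fun _ => ⊤)
        ((𝓡∂ 2).boundary S) ![pushforwardSection φ τ, s] =
      relChernClass (EuclideanSpace ℝ (Fin 2)) j.J (fun _ => ⊤) ((𝓡∂ 2).boundary S) ![τ] +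
      relChernClass (EuclideanSpace ℝ (Fin 4)) (pullbackJ J φ) ν ((𝓡∂ 2).boundary S) ![s] := by
  -- As a bundled continuous map, φ gives the pullback its fibre and vector bundle structures.
  lift φ to C(S, W) using hφ.smooth.continuous
  have hι := isBundleSum_mfderiv hφ hhol hν
  have h₁ := j.isComplexSubbundle.hasSimplexFrames j.J_J j.smooth.continuous
  have h₂ : HasSimplexFrames (EuclideanSpace ℝ (Fin 4)) (pullbackJ J φ) ν 1 :=
    hν.subbundle.hasSimplexFrames (fun x => J.J_J (φ x)) (continuous_pullbackJ J φ)
  have h₃ := hι.hasSimplexFrames h₁ h₂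
  -- Positivity makes the normal component of -j τ strictly negative, which excludes τ = 0.
  have hτ_ne : ∀ x, τ x ≠ 0 := fun x h0 => by
    have := (hτ_pos x).2
    simp [h0] at this
  have hτ : IsFrameAlong (EuclideanSpace ℝ (Fin 2)) j.J (fun _ => ⊤)
      (fun x : (𝓡∂ 2).boundary S => (x : S)) ![τ] :=
    ⟨Fin.forall_fin_one.2 hτ_cont, fun x => j.isComplexBasis (hτ_ne x)⟩
  have hs : IsFrameAlong (EuclideanSpace ℝ (Fin 4)) (pullbackJ J φ) ν
      (fun x : (𝓡∂ 2).boundary S => (x : S)) ![s] := by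
    refine ⟨Fin.forall_fin_one.2 hs_cont, fun x => ?_⟩
    obtain ⟨U, -, hxU, f, hf⟩ := hν.subbundle (x : S)
    exact (hf.basis ⟨x, hxU⟩).of_mem_of_ne_zero (fun v => J.J_J (φ x) v) (hs_mem x) (hs_ne x)
  obtain ⟨Φ₁⟩ := h₁.nonempty_skeletonFrame hτ
  obtain ⟨Φ₂⟩ := h₂.nonempty_skeletonFrame hs
  have e₁ := existsUnique_isRelChernClass h₁ hτ Φ₁
  have e₂ := existsUnique_isRelChernClass h₂ hs Φ₂
  have e₃ := existsUnique_isRelChernClass h₃ (hι.isFrameAlong hτ hs) (Φ₁.pair hι Φ₂)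
  refine ⟨e₃, e₁, e₂, ?_⟩
  obtain ⟨z₁, hz₁, -⟩ := id e₁
  obtain ⟨z₂, hz₂, -⟩ := id e₂
  rw [relChernClass_eq e₁ hz₁, relChernClass_eq e₂ hz₂]
  exact relChernClass_eq e₃ (hz₁.pair hι hz₂)
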